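/- **Proposition 4.1.** Let $\mathfrak g$ be the $N=2$ Ramond algebra, i.e. the complex Lie superalgebra with basis $\{L_m,H_m,G_m^\pm,C\mid m\in\mathbb Z\}$ ($L_m,H_m,C$ even, $G^\pm_m$ odd), $C$ central, and $$[L_m,L_n]=(n-m)L_{m+n}+\tfrac{1}{12}(m^3-m)\delta_{m+n,0}C,\quad [H_m,H_n]=\tfrac13 m\,\delta_{m+n,0}C,\quad [L_m,H_n]=nH_{m+n},$$ $$[L_m,G_p^\pm]=(p-\tfrac m2)G^\pm_{m+p},\quad [H_m,G_p^\pm]=\pm G^\pm_{m+p},\quad [G_p^\pm,G_q^\pm]=0,$$ $$[G_p^+,G_q^-]=-2L_{p+q}+(p-q)H_{p+q}+\tfrac13(p^2-\tfrac14)\delta_{p+q,0}C .$$ Put $G^\pm=\mathrm{span}\{G^\pm_r\mid r\in\mathbb Z\}$ and $\mathfrak q^\pm=\mathrm{span}\{L_m,H_m,G_m^\pm,C\mid m\in\mathbb Z\}$. Modules and submodules are $\mathbb Z_2$-graded, and for a subspace $U$ of a $\mathfrak g$-module, $(G^\pm)^iU$ denotes the span of all $x_1\cdots x_iu$ with $x_j\in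 G^\pm$, $u\in U$. For a $\mathfrak g$-module $V$ and $\mu\in\mathbb C$ let $V_\mu=\{v\in V\mid L_0v=\mu v\}$, and for $\tau\in\mathbb Z_2$ let $(V_\mu)_\tau$ be its part of parity $\tau$. $V$ is called cuspidal if it is the sum of its weight spaces $V_\mu$ and there is a positive integer $p$ with $\dim (V_\mu)_\tau\le p$ for all $\mu$ and $\tau$; the least such $p$ is the length of $V$. Let $V$ be a simple cuspidal $\mathfrak g$-module. Then $\dim (V_\mu)_\tau\le 2$ for all $\mu\in\mathbb C$ and $\tau\in\mathbb Z_2$. Hence the length of $V$ is $1$ or $2$. Moreover there are an integer $0\le n\le 2$, a simple $\mathfrak q^+$-submodule $U^+$ of $V$ with $G^+U^+=0$, and a simple $\mathfrak q^-$-submodule $U^-$ of $V$ with $G^-U^-=0$, such that $$V=\sum_{i=0}^n (G^-)^iU^+=\sum_{i=0}^n (G^+)^iU^-,\qquad (G^-)^iU^+=(G^+)^{n-i}U^-\quad(0\le i\le n).$$ If $\mathfrak g$ does not act as zero on $V$, then $n$ can be taken equal to the length of $V$. -/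

import Mathlib

noncomputable section

/-- The sign `(-1)^{|x||y|}` for parities `a = |x|`, `b = |y|`. -/
def superSign (a b : ZMod 2) : ℂ := (-1) ^ (a.val * b.val)

/-- A complex Lie superalgebra structure on the vector space `g`. -/
structure LieSuperalgebra (g : Type*) [AddCommGroup g] [Module ℂ g] where
  /-- the even part (`0`) and the odd part (`1`) -/
  grading : ZMod 2 → Submodule ℂ g
  /-- the superbracket -/
  bracket : g →ₗ[ℂ] g →ₗ[ℂ] g
  isInternal : DirectSum.IsInternal grading
  bracket_mem : ∀ {a b : ZMod 2} {x y : g}, x ∈ grading a → y ∈ grading b →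
    bracket x y ∈ grading (a + b)
  skew : ∀ {a b : ZMod 2} {x y : g}, x ∈ grading a → y ∈ grading b →
    bracket x y = -(superSign a b • bracket y x)
  jacobi : ∀ {a b c : ZMod 2} {x y z : g}, x ∈ grading a → y ∈ grading b → z ∈ grading c →
    bracket x (bracket y z) = bracket (bracket x y) z + superSign a b • bracket y (bracket x z)

/-- A module structure on the vector space `V` over the Lie superalgebra `A`: a `ℤ/2`-grading of
`V` and a bilinear action that respects the gradings and satisfies
`[x, y] v = x (y v) - (-1)^{|x||y|} y (x v)`. -/
structure SuperRep {g : Type*} [AddCommGroup g] [Module ℂ g] (A : LieSuperalgebra g)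
    (V : Type*) [AddCommGroup V] [Module ℂ V] where
  grading : ZMod 2 → Submodule ℂ V
  action : g →ₗ[ℂ] V →ₗ[ℂ] V
  isInternal : DirectSum.IsInternal grading
  action_mem : ∀ {a b : ZMod 2} {x : g} {v : V}, x ∈ A.grading a → v ∈ grading b →
    action x v ∈ grading (a + b)
  action_bracket : ∀ {a b : ZMod 2} {x y : g}, x ∈ A.grading a → y ∈ A.grading b → ∀ v : V,
    action (A.bracket x y) v = action x (action y v) - superSign a b • action y (action x v)

namespace SuperRep

variable {g : Type*} [AddCommGroup g] [Module ℂ g] {A : LieSuperalgebra g}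
  {V : Type*} [AddCommGroup V] [Module ℂ V]

/-- `U` is a `ℤ/2`-graded subspace of `V`, stable under the elements of `S`. When `S` is the
underlying space of a graded subalgebra, these are the (graded) submodules over it. -/
def IsSubmodule (M : SuperRep A V) (S : Submodule ℂ g) (U : Submodule ℂ V) : Prop :=
  U ≤ (⨆ τ : ZMod 2, U ⊓ M.grading τ) ∧ ∀ x ∈ S, ∀ u ∈ U, M.action x u ∈ U

/-- `U` is a graded `S`-submodule of `V` which is simple as an `S`-module. -/
def IsSimpleSubmodule (M : SuperRep A V) (S : Submodule ℂ g) (U : Submodule ℂ V) : Prop :=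
  M.IsSubmodule S U ∧ U ≠ ⊥ ∧ ∀ W : Submodule ℂ V, M.IsSubmodule S W → W ≤ U → W = ⊥ ∨ W = U

/-- `V` is a simple module over the whole superalgebra. -/
def IsSimple (M : SuperRep A V) : Prop := M.IsSimpleSubmodule ⊤ ⊤

/-- The superalgebra does not act as zero. -/
def IsNontrivial (M : SuperRep A V) : Prop := ∃ x v, M.action x v ≠ 0

/-- `S^i U`, the span of all `x₁ ⋯ xᵢ u` with `xⱼ ∈ S` and `u ∈ U`. -/
def powAct (M : SuperRep A V) (S : Submodule ℂ g) : ℕ → Submodule ℂ V → Submodule ℂ V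
  | 0, U => U
  | i + 1, U => Submodule.map₂ M.action S (M.powAct S i U)

end SuperRep

/-- Labels of the basis `L_m, H_m, G^+_m, G^-_m, C` of the `N = 2` Ramond algebra. -/
inductive RamondIndex : Type
  | L (m : ℤ)
  | H (m : ℤ)
  | Gp (m : ℤ)
  | Gm (m : ℤ)
  | C

namespace RamondIndex

def parity : RamondIndex → ZMod 2
  | L _ => 0
  | H _ => 0
  | Gp _ => 1
  | Gm _ => 1
  | C => 0

/-- `centre k t` is `t δ_{k,0} C`. -/
def centre (k : ℤ) (t : ℂ) : RamondIndex →₀ ℂ := Finsupp.single C (if k = 0 then t else 0)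

/-- The brackets of the basis elements. -/
def br : RamondIndex → RamondIndex → (RamondIndex →₀ ℂ)
  | L m, L n => Finsupp.single (L (m + n)) ((n : ℂ) - m)
      + centre (m + n) (((m : ℂ) ^ 3 - m) / 12)
  | L m, H n => Finsupp.single (H (m + n)) (n : ℂ)
  | H m, L n => Finsupp.single (H (m + n)) (-(m : ℂ))
  | H m, H n => centre (m + n) ((m : ℂ) / 3)
  | L m, Gp p => Finsupp.single (Gp (m + p)) ((p : ℂ) - m / 2)
  | Gp p, L m => Finsupp.single (Gp (m + p)) (-((p : ℂ) - m / 2))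
  | L m, Gm p => Finsupp.single (Gm (m + p)) ((p : ℂ) - m / 2)
  | Gm p, L m => Finsupp.single (Gm (m + p)) (-((p : ℂ) - m / 2))
  | H m, Gp p => Finsupp.single (Gp (m + p)) 1
  | Gp p, H m => Finsupp.single (Gp (m + p)) (-1)
  | H m, Gm p => Finsupp.single (Gm (m + p)) (-1)
  | Gm p, H m => Finsupp.single (Gm (m + p)) 1
  | Gp p, Gm q => Finsupp.single (L (p + q)) (-2) + Finsupp.single (H (p + q)) ((p : ℂ) - q)
      + centre (p + q) (((p : ℂ) ^ 2 - 1 / 4) / 3)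
  | Gm q, Gp p => Finsupp.single (L (p + q)) (-2) + Finsupp.single (H (p + q)) ((p : ℂ) - q)
      + centre (p + q) (((p : ℂ) ^ 2 - 1 / 4) / 3)
  | Gp _, Gp _ => 0
  | Gm _, Gm _ => 0
  | C, _ => 0
  | _, C => 0

/-- The bilinear extension of `br`. -/
def bracket : (RamondIndex →₀ ℂ) →ₗ[ℂ] (RamondIndex →₀ ℂ) →ₗ[ℂ] (RamondIndex →₀ ℂ) :=
  Finsupp.lift _ ℂ _ fun i => Finsupp.lift _ ℂ _ fun j => br i j

theorem bracket_single (i j : RamondIndex) (s t : ℂ) :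
    bracket (Finsupp.single i s) (Finsupp.single j t) = (s * t) • br i j := by
  simp [bracket, smul_smul]

/-- The even and the odd part. -/
def gr (τ : ZMod 2) : Submodule ℂ (RamondIndex →₀ ℂ) :=
  Finsupp.supported ℂ ℂ {i | i.parity = τ}

theorem gr_eq_span (τ : ZMod 2) :
    gr τ = Submodule.span ℂ ((fun i => Finsupp.single i (1 : ℂ)) '' {i | i.parity = τ}) :=
  Finsupp.supported_eq_span_single _ _

theorem single_mem_gr {i : RamondIndex} {τ : ZMod 2} (h : i.parity = τ) (t : ℂ) :
    Finsupp.single i t ∈ gr τ := Finsupp.single_mem_supported ℂ t h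

theorem gr_induction {τ : ZMod 2} {P : (RamondIndex →₀ ℂ) → Prop}
    (hs : ∀ i : RamondIndex, i.parity = τ → P (Finsupp.single i 1)) (h0 : P 0)
    (ha : ∀ x y, P x → P y → P (x + y)) (hm : ∀ (t : ℂ) x, P x → P (t • x))
    {x : RamondIndex →₀ ℂ} (hx : x ∈ gr τ) : P x := by
  rw [gr_eq_span] at hx
  induction hx using Submodule.span_induction with
  | mem x h => obtain ⟨i, hi, rfl⟩ := h; exact hs i hi
  | zero => exact h0
  | add x y _ _ h1 h2 => exact ha x y h1 h2
  | smul t x _ h => exact hm t x h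

theorem br_mem (i j : RamondIndex) : br i j ∈ gr (i.parity + j.parity) := by
  have h11 : (1 : ZMod 2) + 1 = 0 := by decide
  cases i <;> cases j <;> simp only [br, parity, centre, h11, add_zero, zero_add] <;>
    first
      | exact Submodule.zero_mem _
      | exact single_mem_gr (by simp [parity]) _
      | exact Submodule.add_mem _ (single_mem_gr (by simp [parity]) _)
          (single_mem_gr (by simp [parity]) _)
      | exact Submodule.add_mem _ (Submodule.add_mem _ (single_mem_gr (by simp [parity]) _)
          (single_mem_gr (by simp [parity]) _)) (single_mem_gr (by simp [parity]) _)

theorem superSign_zero_left (a : ZMod 2) : superSign 0 a = 1 := by simp [superSign]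
theorem superSign_zero_right (a : ZMod 2) : superSign a 0 = 1 := by simp [superSign]
theorem superSign_one_one : superSign 1 1 = -1 := by
  simp [superSign, ZMod.val_one]

theorem br_skew (i j : RamondIndex) : br i j = -(superSign i.parity j.parity • br j i) := by
  classical
  rcases i with m | m | m | m | _ <;> rcases j with n | n | n | n | _ <;>
    simp only [br, centre, parity, superSign_zero_left, superSign_zero_right, superSign_one_one] <;>
    ext x <;> rcases x with r | r | r | r | _ <;>
    (try simp [Finsupp.single_apply]) <;> (try split_ifs) <;>
    first
      | (exfalso; omega)
      | ring1
      | (obtain rfl : m = -n := by omega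
         push_cast
         ring1)

set_option maxHeartbeats 4000000 in
theorem br_jacobi (i j k : RamondIndex) :
    bracket (Finsupp.single i 1) (br j k) = bracket (br i j) (Finsupp.single k 1)
      + superSign i.parity j.parity • bracket (Finsupp.single j 1) (br i k) := by
  classical
  rcases i with m | m | m | m | _ <;> rcases j with n | n | n | n | _ <;>
    rcases k with p | p | p | p | _ <;>
    simp only [br, centre, parity, superSign_zero_left, superSign_zero_right, superSign_one_one,
      map_add, LinearMap.add_apply, bracket_single, map_zero, LinearMap.zero_apply,
      one_smul, one_mul, mul_one, smul_zero, add_zero, zero_add, neg_smul] <;>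
    ext x <;> rcases x with r | r | r | r | _ <;>
    simp only [Finsupp.add_apply, Finsupp.neg_apply, Finsupp.smul_apply, Finsupp.coe_zero,
      Pi.zero_apply, Finsupp.single_apply, smul_eq_mul, L.injEq, H.injEq, Gp.injEq, Gm.injEq,
      reduceCtorEq, if_false, if_true, mul_zero, add_zero, zero_add, neg_zero] <;>
    (try split_ifs) <;>
    first
      | (exfalso; omega)
      | (push_cast; ring1)
      | (obtain rfl : m = -(n + p) := by omega
         push_cast
         ring1)

theorem gr_isInternal : DirectSum.IsInternal gr := by
  have h : IsCompl {i : RamondIndex | i.parity = 0} {i | i.parity = 1} := by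
    rw [isCompl_iff, disjoint_iff, codisjoint_iff]
    constructor <;> ext i <;> cases i <;> simp [parity]
  refine (DirectSum.isInternal_submodule_iff_isCompl gr (i := 0) (j := 1) (by decide) ?_).2
    ⟨Finsupp.disjoint_supported_supported h.1, Finsupp.codisjoint_supported_supported h.2⟩
  ext x
  have : x = 0 ∨ x = 1 := by revert x; decide
  simpa using this

theorem bracket_mem_gr {a b : ZMod 2} {x y : RamondIndex →₀ ℂ} (hx : x ∈ gr a) (hy : y ∈ gr b) :
    bracket x y ∈ gr (a + b) := by
  refine gr_induction (P := fun x => bracket x y ∈ gr (a + b)) (fun i hi => ?_) (by simp)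
    (fun x x' h1 h2 => by simpa using Submodule.add_mem _ h1 h2)
    (fun t x h => by simpa using Submodule.smul_mem _ t h) hx
  refine gr_induction (P := fun y => bracket _ y ∈ gr (a + b)) (fun j hj => ?_) (by simp)
    (fun x x' h1 h2 => by simpa using Submodule.add_mem _ h1 h2)
    (fun t x h => by simpa using Submodule.smul_mem _ t h) hy
  rw [bracket_single, ← hi, ← hj, mul_one, one_smul]
  exact br_mem i j

theorem bracket_skew {a b : ZMod 2} {x y : RamondIndex →₀ ℂ} (hx : x ∈ gr a) (hy : y ∈ gr b) :
    bracket x y = -(superSign a b • bracket y x) := by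
  refine gr_induction (P := fun x => bracket x y = -(superSign a b • bracket y x))
    (fun i hi => ?_) (by simp)
    (fun x x' h1 h2 => by simp only [map_add, LinearMap.add_apply, h1, h2]; module)
    (fun t x h => by simp only [map_smul, LinearMap.smul_apply, h]; module) hx
  refine gr_induction (P := fun y => bracket _ y = -(superSign a b • bracket y _))
    (fun j hj => ?_) (by simp)
    (fun x x' h1 h2 => by simp only [map_add, LinearMap.add_apply, h1, h2]; module)
    (fun t x h => by simp only [map_smul, LinearMap.smul_apply, h]; module) hy
  rw [bracket_single, bracket_single, ← hi, ← hj, mul_one, one_smul, one_smul]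
  exact br_skew i j

theorem bracket_jacobi {a b c : ZMod 2} {x y z : RamondIndex →₀ ℂ}
    (hx : x ∈ gr a) (hy : y ∈ gr b) (hz : z ∈ gr c) :
    bracket x (bracket y z) =
      bracket (bracket x y) z + superSign a b • bracket y (bracket x z) := by
  refine gr_induction (P := fun x => bracket x (bracket y z) =
      bracket (bracket x y) z + superSign a b • bracket y (bracket x z)) (fun i hi => ?_) (by simp)
    (fun x x' h1 h2 => by simp only [map_add, LinearMap.add_apply, h1, h2]; module)
    (fun t x h => by simp only [map_smul, LinearMap.smul_apply, h]; module) hx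
  refine gr_induction (P := fun y => bracket _ (bracket y z) =
      bracket (bracket _ y) z + superSign a b • bracket y (bracket _ z)) (fun j hj => ?_) (by simp)
    (fun x x' h1 h2 => by simp only [map_add, LinearMap.add_apply, h1, h2]; module)
    (fun t x h => by simp only [map_smul, LinearMap.smul_apply, h]; module) hy
  refine gr_induction (P := fun z => bracket _ (bracket _ z) =
      bracket (bracket _ _) z + superSign a b • bracket _ (bracket _ z)) (fun k _ => ?_) (by simp)
    (fun x x' h1 h2 => by simp only [map_add, h1, h2]; module)
    (fun t x h => by simp only [map_smul, h]; module) hz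
  have h := br_jacobi i j k
  rw [hi, hj] at h
  simpa [bracket_single] using h

end RamondIndex

/-- The `N = 2` Ramond algebra. -/
def ramond : LieSuperalgebra (RamondIndex →₀ ℂ) where
  grading := RamondIndex.gr
  bracket := RamondIndex.bracket
  isInternal := RamondIndex.gr_isInternal
  bracket_mem := RamondIndex.bracket_mem_gr
  skew := RamondIndex.bracket_skew
  jacobi := RamondIndex.bracket_jacobi

namespace RamondIndex

/-- The span `G^+` of all `G^+_r`. -/
def spanGp : Submodule ℂ (RamondIndex →₀ ℂ) :=
  Submodule.span ℂ (Set.range fun r : ℤ => Finsupp.single (Gp r) 1)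

/-- The span `G^-` of all `G^-_r`. -/
def spanGm : Submodule ℂ (RamondIndex →₀ ℂ) :=
  Submodule.span ℂ (Set.range fun r : ℤ => Finsupp.single (Gm r) 1)

/-- The subalgebra `q^+`, the span of all `L_m`, `H_m`, `C` (the even part) and all `G^+_m`. -/
def qPlus : Submodule ℂ (RamondIndex →₀ ℂ) := gr 0 ⊔ spanGp

/-- The subalgebra `q^-`, the span of all `L_m`, `H_m`, `C` (the even part) and all `G^-_m`. -/
def qMinus : Submodule ℂ (RamondIndex →₀ ℂ) := gr 0 ⊔ spanGm

end RamondIndex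

namespace SuperRep

variable {V : Type*} [AddCommGroup V] [Module ℂ V]

/-- The weight space `V_μ = {v | L_0 v = μ v}`. -/
def weightSpace (M : SuperRep ramond V) (μ : ℂ) : Submodule ℂ V :=
  Module.End.eigenspace (M.action (Finsupp.single (RamondIndex.L 0) 1)) μ

/-- `dim (V_μ)_τ ≤ p` (and finite) for all weights `μ` and both parities `τ`. -/
def DimLE (M : SuperRep ramond V) (p : ℕ) : Prop :=
  ∀ (μ : ℂ) (τ : ZMod 2),
    FiniteDimensional ℂ ↥(M.weightSpace μ ⊓ M.grading τ) ∧
      Module.finrank ℂ ↥(M.weightSpace μ ⊓ M.grading τ) ≤ p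

/-- A cuspidal module: a weight module (the sum of its weight spaces) for which the dimensions of
the homogeneous parts of the weight spaces are uniformly bounded. -/
def IsCuspidal (M : SuperRep ramond V) : Prop :=
  (⨆ μ : ℂ, M.weightSpace μ) = ⊤ ∧ ∃ p : ℕ, 0 < p ∧ M.DimLE p

/-- The length of a cuspidal module is the least positive `p` with `dim (V_μ)_τ ≤ p` for all
`μ` and `τ`. -/
def IsLength (M : SuperRep ramond V) (p : ℕ) : Prop :=
  IsLeast {q : ℕ | 0 < q ∧ M.DimLE q} p

end SuperRep

end

/-! ### Eigenspace decompositions and pencils of bounded rank. -/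

section LinearAlgebra

variable {V : Type*} [AddCommGroup V] [Module ℂ V]

/-! The bounded multiplicities first force `C` to act as zero (`heisenberg_charge_eq_zero`). A
homogeneous joint eigenvector of `L_0` and `H_0` generates the module, so `H_0` is diagonalizable
with eigenvalues in one coset of the integers. As `G^±` shifts both the `H_0`-eigenvalue by `±1` and
the parity, each `H_0`-eigenspace ("level") has a single parity. A counting argument
(`IsSimpleBounded.exists_level_bound`) shows that there is a highest level.

The highest level is killed by `G^+`, so by simplicity the powers of `G^-` applied to it, or to any
nonzero part of it stable under the even subalgebra, fill the module level by level. Hence the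
highest level is simple over the even part, and a vector one level below killed by all `G^+_p` is
zero.

The heart is that the highest level has an intermediate series form: it is spanned by vectors `u_n`
with `H_k u_n = h u_{n+k}` and `L_m u_n = (lam + n + m κ) u_{n+m}` (`IsTop.exists_family`,
`IsTop.exists_basis`). The bound on the multiplicities of the whole module makes a space of
sequences in this level finite dimensional, because `G^+_{n-j} G^-_{j-a} u` is affine in `j` and
factors through one weight space (`IsTop.finiteDimensional_seqSpan`). The degree-zero operators
`t^{-k} H_k` and `t^{-m} L_m` act on that space and have a common eigenvector there
(`PointedWitt.exists_common_eigenvector`), which is the family `u`.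

Testing against `G^+` shows that `G^-_q u_n`, for fixed `n + q`, is affine in `q`. Anticommutation
then makes `G^-_p G^-_q u_n` a multiple `q - p` of one vector depending on `n + p + q`, and triple
products vanish. So there are at most three levels, of multiplicities at most 1, 2, 1, and the outer
two share a parity. The number `n` is the depth of the level diagram; exchanging `G^+` and `G^-`
yields everything about the lowest level. -/

theorem iSupIndep.mem_of_mem_iSup {ι : Type*} {A B : ι → Submodule ℂ V} (hB : iSupIndep B)
    (hAB : ∀ i, A i ≤ B i) {i : ι} {x : V} (hx : x ∈ B i) (hxA : x ∈ ⨆ j, A j) : x ∈ A i := by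
  have h1 : (⨆ j, A j) ≤ A i ⊔ ⨆ (j) (_ : j ≠ i), B j := by
    refine iSup_le fun j => ?_
    by_cases hj : j = i
    · subst hj; exact le_sup_left
    · exact le_trans ((hAB j).trans (le_iSup₂_of_le j hj le_rfl)) le_sup_right
  obtain ⟨y, hy, z, hz, rfl⟩ := Submodule.mem_sup.1 (h1 hxA)
  have hzB : z ∈ B i := by
    have := Submodule.sub_mem _ hx (hAB i hy)
    simpa using this
  have : z = 0 := by
    have := (hB i).le_bot ⟨hzB, hz⟩
    simpa using this
  simpa [this] using hy

/-- Applying `T - g a` removes the summand at `a` and rescales the others by nonzero factors, so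
induction on the number of summands applies. -/
theorem mem_of_sum_eigenvectors_mem {ι : Type*} (T : Module.End ℂ V) {g : ι → ℂ}
    (hg : Function.Injective g) (W : Submodule ℂ V) (hW : ∀ w ∈ W, T w ∈ W) (s : Finset ι) :
    ∀ v : ι → V, (∀ i ∈ s, T (v i) = g i • v i) → (∑ i ∈ s, v i) ∈ W → ∀ i ∈ s, v i ∈ W := by
  classical
  induction s using Finset.induction_on with
  | empty => simp
  | insert a s ha ih =>
    intro v hv hs
    have key : ∀ i ∈ s, (g i - g a) • v i ∈ W := by
      refine ih (fun i => (g i - g a) • v i) (fun i hi => ?_) ?_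
      · rw [map_smul, hv i (Finset.mem_insert_of_mem hi), smul_comm]
      · have h1 := W.sub_mem (hW _ hs) (W.smul_mem (g a) hs)
        rw [map_sum, Finset.smul_sum, ← Finset.sum_sub_distrib, Finset.sum_insert ha,
          hv a (Finset.mem_insert_self _ _), sub_self, zero_add] at h1
        convert h1 using 1
        refine Finset.sum_congr rfl fun i hi => ?_
        rw [hv i (Finset.mem_insert_of_mem hi), sub_smul]
    have key2 : ∀ i ∈ s, v i ∈ W := fun i hi => by
      have hne : g i - g a ≠ 0 := sub_ne_zero.2 fun h => ha (hg h ▸ hi)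
      exact (W.smul_mem_iff hne).1 (key i hi)
    intro i hi
    rcases Finset.mem_insert.1 hi with rfl | hi
    · rw [Finset.sum_insert ha] at hs
      have := W.sub_mem hs (W.sum_mem key2)
      simpa using this
    · exact key2 i hi

theorem le_iSup_inf_eigenspace {ι : Type*} (T : Module.End ℂ V) {g : ι → ℂ}
    (hg : Function.Injective g) (W : Submodule ℂ V) (hW : ∀ w ∈ W, T w ∈ W)
    (hT : W ≤ ⨆ i, T.eigenspace (g i)) : W ≤ ⨆ i, W ⊓ T.eigenspace (g i) := by
  intro w hw
  obtain ⟨f, hf, rfl⟩ := (Submodule.mem_iSup_iff_exists_finsupp _ _).1 (hT hw)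
  have := mem_of_sum_eigenvectors_mem T hg W hW f.support f
    (fun i _ => Module.End.mem_eigenspace_iff.1 (hf i)) hw
  exact Submodule.sum_mem _ fun i hi => Submodule.mem_iSup_of_mem i ⟨this i hi, hf i⟩

/-- A pencil `A + j B` of uniformly bounded rank has `B` of finite rank. -/
theorem finiteDimensional_range_of_pencil {D X : Type*} [AddCommGroup D] [Module ℂ D]
    [AddCommGroup X] [Module ℂ X] (A B : D →ₗ[ℂ] X) (N : ℕ)
    (h : ∀ j : ℤ, FiniteDimensional ℂ (LinearMap.range (A + (j : ℂ) • B)) ∧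
      Module.finrank ℂ (LinearMap.range (A + (j : ℂ) • B)) ≤ N) :
    FiniteDimensional ℂ (LinearMap.range B) := by
  by_contra hB
  have hrank : ((N + 1 : ℕ) : Cardinal) ≤ LinearMap.rank B := by
    have hB' := not_lt.1 fun hlt => hB (Module.rank_lt_aleph0_iff.1 hlt)
    exact Cardinal.natCast_lt_aleph0.le.trans hB'
  obtain ⟨s, hs, hli⟩ := LinearMap.le_rank_iff_exists_linearIndependent_finset.1 hrank
  let i : (s → ℂ) →ₗ[ℂ] D := Fintype.linearCombination ℂ (fun x : s => (x : D))
  have hinj : LinearMap.ker (B ∘ₗ i) = ⊥ := by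
    rw [LinearMap.ker_eq_bot']
    intro f hf
    have := Fintype.linearIndependent_iff.1 hli f (by
      simpa [i, Fintype.linearCombination_apply, map_sum] using hf)
    exact funext this
  obtain ⟨r, hr⟩ := (B ∘ₗ i).exists_leftInverse_of_injective hinj
  -- On the `(N + 1)`-dimensional source of `i` the map `B` is injective with left inverse `r`, so
  -- `r (A + j B) i = E + j`. This is injective unless `-j` is one of the finitely many eigenvalues
  -- of `E`; any other integer `j` gives rank at least `N + 1`.
  let E : Module.End ℂ (s → ℂ) := r ∘ₗ A ∘ₗ i
  have hfin := E.finite_hasEigenvalue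
  obtain ⟨j, hj⟩ : ∃ j : ℤ, ¬ E.HasEigenvalue (-(j : ℂ)) := by
    by_contra! hall
    have hinj : Function.Injective fun j : ℤ => -(j : ℂ) := fun a b hab => by simpa using hab
    exact Set.infinite_univ ((hfin.preimage hinj.injOn).subset fun j _ => hall j)
  have hker : LinearMap.ker ((A + (j : ℂ) • B) ∘ₗ i) = ⊥ := by
    rw [LinearMap.ker_eq_bot']
    intro f hf
    by_contra hf0
    refine hj (Module.End.hasEigenvalue_of_hasEigenvector (x := f) ⟨?_, hf0⟩)
    rw [Module.End.mem_eigenspace_iff]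
    have h1 := congrArg r hf
    have h2 : r (B (i f)) = f := LinearMap.congr_fun hr f
    simp only [LinearMap.comp_apply, LinearMap.add_apply, LinearMap.smul_apply, map_add, map_smul,
      h2, map_zero] at h1
    rw [neg_smul]
    exact eq_neg_of_add_eq_zero_left h1
  obtain ⟨hfd, hle⟩ := h j
  have h3 : Module.finrank ℂ (s → ℂ) ≤ N := by
    refine le_trans ?_ hle
    let g : (s → ℂ) →ₗ[ℂ] LinearMap.range (A + (j : ℂ) • B) :=
      (A + (j : ℂ) • B).rangeRestrict ∘ₗ i
    refine LinearMap.finrank_le_finrank_of_injective (f := g) ?_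
    rw [← LinearMap.ker_eq_bot, LinearMap.ker_eq_bot']
    intro f hf
    refine LinearMap.ker_eq_bot'.1 hker f ?_
    exact congrArg Subtype.val hf
  simp at h3
  omega

end LinearAlgebra

/-! ### A common eigenvector for vector fields on the circle vanishing at `t = 1`, together with
functions. -/

section CommonEigenvector

variable {F : Type*} [AddCommGroup F] [Module ℂ F]

/-- Operators `y m` and `x k` satisfying the relations of the Lie algebra of the vector fields
`(t ^ m - 1) t ∂` and the functions `t ^ k`. -/
structure PointedWitt (x y : ℤ → Module.End ℂ F) (h : ℂ) : Prop where
  yy : ∀ m n f, y m (y n f) = y n (y m f) + ((n : ℂ) - m) • y (m + n) f - (n : ℂ) • y n f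
    + (m : ℂ) • y m f
  yx : ∀ m k f, y m (x k f) = x k (y m f) + (k : ℂ) • (x (m + k) f - x k f)
  y_zero : ∀ f, y 0 f = 0
  x_zero : ∀ f, x 0 f = h • f

namespace PointedWitt

variable {x y : ℤ → Module.End ℂ F} {h : ℂ}

/-- The symmetry `t ↦ t⁻¹`. -/
theorem inv (H : PointedWitt x y h) :
    PointedWitt (fun k => x (-k)) (fun m => -y (-m)) h where
  yy m n f := by
    simp only [LinearMap.neg_apply, map_neg, neg_neg]
    rw [H.yy (-m) (-n) f, show -(m + n) = -m + -n by ring]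
    push_cast
    module
  yx m k f := by
    simp only [LinearMap.neg_apply, map_neg]
    rw [H.yx (-m) (-k) f, show -(m + k) = -m + -k by ring]
    push_cast
    module
  y_zero f := by simp [H.y_zero]
  x_zero f := by simp [H.x_zero]

theorem eq_zero_of_raise {T : Module.End ℂ F} {μ : ℂ}
    (hT : ∀ ν, T.HasEigenvalue ν → ν.re ≤ μ.re) {c : ℂ} (hc : μ.re < c.re) {f : F}
    (hf : T f = c • f) : f = 0 := by
  by_contra h0
  have := hT c (Module.End.hasEigenvalue_of_hasEigenvector
    ⟨Module.End.mem_eigenspace_iff.2 hf, h0⟩)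
  linarith

/-- The operator `-y (-1)` is the Euler field `(t - 1) ∂` at the fixed point `t = 1`. Elements
vanishing there to higher order raise its eigenvalue by a positive integer, so they kill an
eigenvector whose eigenvalue has maximal real part. The indices `-2` and `-1` are treated the same
way with `y 1`, the Euler field up to sign in the coordinate `t⁻¹`; this is why both spectra must be
bounded by `κ`. -/
theorem eigenvector_of_max (H : PointedWitt x y h) {κ : ℂ} {f : F} (hf : y (-1) f = -κ • f)
    (h1 : ∀ ν, (-y (-1)).HasEigenvalue ν → ν.re ≤ κ.re)
    (h2 : ∀ ν, (y 1).HasEigenvalue ν → ν.re ≤ κ.re) :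
    (∀ k, x k f = h • f) ∧ ∀ m : ℤ, y m f = ((m : ℂ) * κ) • f := by
  have y1 : y 1 f = κ • f := by
    have : y 1 f + y (-1) f = 0 := by
      refine eq_zero_of_raise h1 (c := κ + 1) (by simp) ?_
      have e := H.yy (-1) 1 f
      simp only [LinearMap.neg_apply, map_add, e, hf, map_smul, map_neg, neg_smul]
      norm_num [H.y_zero, hf]
      module
    rw [eq_neg_of_add_eq_zero_left this, hf]; module
  have y2 : y 2 f = (2 * κ) • f := by
    -- This combination is the field `(t - 1) ^ 3 ∂`, of weight 2 for the Euler field.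
    have : y 2 f - (3 : ℂ) • y 1 f - y (-1) f = 0 := by
      refine eq_zero_of_raise h1 (c := κ + 2) (by simp) ?_
      have e := H.yy (-1) 2 f
      simp only [LinearMap.neg_apply, map_sub, e, hf, map_smul, map_neg, neg_smul, y1]
      norm_num [H.y_zero, hf, y1]
      module
    have e : y 2 f = (3 : ℂ) • y 1 f + y (-1) f := by
      rw [← sub_eq_zero, ← this]; module
    rw [e, y1, hf]; module
  -- The bracket of `y 1` with `y (n + 2)` contains `y (n + 3)` with coefficient `n + 1`, which is
  -- nonzero. The index 2 itself is out of reach, since `y 1` commutes with itself; hence the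
  -- separate argument for `y2`.
  have ypos : ∀ n : ℕ, y ((n : ℤ) + 2) f = (((n : ℂ) + 2) * κ) • f := by
    intro n
    induction n with
    | zero => simpa using y2
    | succ n ih =>
      have e := H.yy 1 ((n : ℤ) + 2) f
      rw [ih, y1, map_smul, map_smul, ih, y1, show (1 : ℤ) + (n + 2) = n + 1 + 2 by ring] at e
      have hne : ((n : ℂ) + 1) ≠ 0 := by exact_mod_cast Nat.succ_ne_zero n
      have : ((n : ℂ) + 1) • y ((n : ℤ) + 1 + 2) f =
          ((n : ℂ) + 1) • (((n : ℂ) + 1 + 2) * κ) • f := by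
        push_cast at e
        have e' : ((n : ℂ) + 2 - 1) • y ((n : ℤ) + 1 + 2) f =
          ((n : ℂ) + 2) • (((n : ℂ) + 2) * κ) • f - (1 : ℂ) • κ • f := by
          rw [← sub_eq_zero] at e ⊢
          rw [← neg_eq_zero, ← e]; module
        rw [show (n : ℂ) + 1 = n + 2 - 1 by ring, e']; module
      have := smul_right_injective F hne this
      push_cast
      exact this
  have ym2 : y (-2) f = (-2 * κ) • f := by
    have : y (-2) f + (2 * κ) • f = 0 := by
      refine eq_zero_of_raise h2 (c := κ + 2) (by simp) ?_
      have e := H.yy 1 (-2) f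
      simp only [map_add, e, map_smul, y1]
      norm_num [hf]
      module
    rw [eq_neg_of_add_eq_zero_left this]; module
  have yneg : ∀ n : ℕ, y (-((n : ℤ) + 2)) f = (-((n : ℂ) + 2) * κ) • f := by
    intro n
    induction n with
    | zero => simpa using ym2
    | succ n ih =>
      have e := H.yy (-1) (-((n : ℤ) + 2)) f
      rw [ih, hf, map_smul, map_smul, ih, hf,
        show (-1 : ℤ) + -(n + 2) = -(n + 1 + 2) by ring] at e
      have hne : ((n : ℂ) + 1) ≠ 0 := by exact_mod_cast Nat.succ_ne_zero n
      have : ((n : ℂ) + 1) • y (-((n : ℤ) + 1 + 2)) f =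
          ((n : ℂ) + 1) • (-((n : ℂ) + 1 + 2) * κ) • f := by
        push_cast at e
        rw [← sub_eq_zero] at e ⊢
        rw [← e]; module
      have := smul_right_injective F hne this
      push_cast
      exact this
  have x1 : x 1 f = h • f := by
    have : x 1 f - x 0 f = 0 := by
      refine eq_zero_of_raise h1 (c := κ + 1) (by simp) ?_
      have e := H.yx (-1) 1 f
      simp only [LinearMap.neg_apply, map_sub, e, H.x_zero, hf, map_smul]
      norm_num [H.x_zero]
      module
    rw [sub_eq_zero.1 this, H.x_zero]
  have xpos : ∀ n : ℕ, x ((n : ℤ) + 1) f = h • f := by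
    intro n
    induction n with
    | zero => simpa using x1
    | succ n ih =>
      have e := H.yx 1 ((n : ℤ) + 1) f
      rw [ih, y1, map_smul, map_smul, ih, y1, smul_comm h κ, left_eq_add,
        smul_eq_zero_iff_right (by exact_mod_cast Nat.succ_ne_zero n), sub_eq_zero] at e
      rw [← e]; congr 2; push_cast; ring
  have xm1 : x (-1) f = h • f := by
    have : x (-1) f - h • f = 0 := by
      refine eq_zero_of_raise h2 (c := κ + 1) (by simp) ?_
      have e := H.yx 1 (-1) f
      simp only [map_sub, e, y1, map_smul]
      norm_num [H.x_zero]
      module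
    rw [sub_eq_zero.1 this]
  have xneg : ∀ n : ℕ, x (-((n : ℤ) + 1)) f = h • f := by
    intro n
    induction n with
    | zero => simpa using xm1
    | succ n ih =>
      have e := H.yx (-1) (-((n : ℤ) + 1)) f
      rw [ih, hf, map_smul, map_smul, ih, hf, smul_comm h (-κ), left_eq_add,
        smul_eq_zero_iff_right (by
          push_cast; exact neg_ne_zero.2 (by exact_mod_cast Nat.succ_ne_zero n)), sub_eq_zero] at e
      rw [← e]; congr 2; push_cast; ring
  constructor
  · intro k
    rcases lt_trichotomy k 0 with hk | rfl | hk
    · obtain ⟨n, rfl⟩ : ∃ n : ℕ, k = -((n : ℤ) + 1) := ⟨(-k - 1).toNat, by omega⟩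
      exact xneg n
    · exact H.x_zero f
    · obtain ⟨n, rfl⟩ : ∃ n : ℕ, k = (n : ℤ) + 1 := ⟨(k - 1).toNat, by omega⟩
      exact xpos n
  · intro m
    rcases lt_trichotomy m 0 with hm | rfl | hm
    · by_cases hm1 : m = -1
      · subst hm1; rw [hf]; push_cast; module
      · obtain ⟨n, rfl⟩ : ∃ n : ℕ, m = -((n : ℤ) + 2) := ⟨(-m - 2).toNat, by omega⟩
        rw [yneg n]; push_cast; rfl
    · simp [H.y_zero]
    · by_cases hm1 : m = 1
      · subst hm1; rw [y1]; push_cast; module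
      · obtain ⟨n, rfl⟩ : ∃ n : ℕ, m = (n : ℤ) + 2 := ⟨(m - 2).toNat, by omega⟩
        rw [ypos n]; push_cast; rfl

/-- Of the eigenvalues of `-y (-1)` and `y 1`, one of largest real part is taken; the symmetry `t ↦
t⁻¹` exchanges the two operators. -/
theorem exists_common_eigenvector [FiniteDimensional ℂ F] [Nontrivial F]
    (H : PointedWitt x y h) :
    ∃ (f : F) (κ : ℂ), f ≠ 0 ∧ (∀ k, x k f = h • f) ∧ ∀ m : ℤ, y m f = ((m : ℂ) * κ) • f := by
  have hex : ∀ T : Module.End ℂ F, ∃ κ, T.HasEigenvalue κ ∧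
      ∀ ν, T.HasEigenvalue ν → ν.re ≤ κ.re := fun T => by
    obtain ⟨κ, hκ, hmax⟩ := Set.exists_max_image {ν | T.HasEigenvalue ν} Complex.re
      T.finite_hasEigenvalue (Module.End.exists_eigenvalue T)
    exact ⟨κ, hκ, hmax⟩
  obtain ⟨κ₁, hκ₁, hmax₁⟩ := hex (-y (-1))
  obtain ⟨κ₂, hκ₂, hmax₂⟩ := hex (y 1)
  rcases le_total κ₂.re κ₁.re with hle | hle
  · obtain ⟨f, hf, hf0⟩ := hκ₁.exists_hasEigenvector
    rw [Module.End.mem_eigenspace_iff] at hf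
    have := H.eigenvector_of_max (κ := κ₁) (f := f)
      (by rw [neg_smul, ← hf]; simp) hmax₁ fun ν hν => (hmax₂ ν hν).trans hle
    exact ⟨f, κ₁, hf0, this⟩
  · obtain ⟨f, hf, hf0⟩ := hκ₂.exists_hasEigenvector
    rw [Module.End.mem_eigenspace_iff] at hf
    have := H.inv.eigenvector_of_max (κ := κ₂) (f := f) (by simp [hf])
      (by simpa using hmax₂) fun ν hν => (hmax₁ ν hν).trans hle
    refine ⟨f, κ₂, hf0, fun k => by simpa using this.1 (-k), fun m => ?_⟩
    have := this.2 (-m)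
    simp only [neg_neg, LinearMap.neg_apply] at this
    rw [← neg_neg (y m f), this]; push_cast; module

end PointedWitt

end CommonEigenvector
-- Operators with central charge zero, and their grading by `L_0` and `H_0`.
/-- Operators on `V` satisfying the relations of the `N = 2` Ramond algebra with central charge
zero; `P` and `Q` stand for `G^+` and `G^-`. -/
structure N2Ops (V : Type*) [AddCommGroup V] [Module ℂ V] where
  L : ℤ → Module.End ℂ V
  H : ℤ → Module.End ℂ V
  P : ℤ → Module.End ℂ V
  Q : ℤ → Module.End ℂ V
  LL : ∀ m n v, L m (L n v) = L n (L m v) + ((n : ℂ) - m) • L (m + n) v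
  LH : ∀ m n v, L m (H n v) = H n (L m v) + (n : ℂ) • H (m + n) v
  HH : ∀ m n v, H m (H n v) = H n (H m v)
  LP : ∀ m p v, L m (P p v) = P p (L m v) + ((p : ℂ) - m / 2) • P (m + p) v
  LQ : ∀ m p v, L m (Q p v) = Q p (L m v) + ((p : ℂ) - m / 2) • Q (m + p) v
  HP : ∀ m p v, H m (P p v) = P p (H m v) + P (m + p) v
  HQ : ∀ m p v, H m (Q p v) = Q p (H m v) - Q (m + p) v
  PP : ∀ p q v, P p (P q v) = -P q (P p v)
  QQ : ∀ p q v, Q p (Q q v) = -Q q (Q p v)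
  PQ : ∀ p q v, P p (Q q v) =
    -Q q (P p v) + (-2 : ℂ) • L (p + q) v + ((p : ℂ) - q) • H (p + q) v

/-- `T ^ i U`, the span of all `T r₁ ⋯ T rᵢ u` with `u ∈ U`. -/
def opPow {V : Type*} [AddCommGroup V] [Module ℂ V] (T : ℤ → Module.End ℂ V) :
    ℕ → Submodule ℂ V → Submodule ℂ V
  | 0, U => U
  | i + 1, U => ⨆ r, (opPow T i U).map (T r)

theorem mem_opPow_succ {V : Type*} [AddCommGroup V] [Module ℂ V] {T : ℤ → Module.End ℂ V}
    {i : ℕ} {U : Submodule ℂ V} {v : V} (hv : v ∈ opPow T i U) (r : ℤ) :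
    T r v ∈ opPow T (i + 1) U :=
  Submodule.mem_iSup_of_mem r (Submodule.mem_map_of_mem hv)

theorem opPow_succ_le {V : Type*} [AddCommGroup V] [Module ℂ V] {T : ℤ → Module.End ℂ V}
    {i : ℕ} {U W : Submodule ℂ V} (h : ∀ v ∈ opPow T i U, ∀ r, T r v ∈ W) :
    opPow T (i + 1) U ≤ W :=
  iSup_le fun r => Submodule.map_le_iff_le_comap.2 fun v hv => h v hv r

namespace N2Ops

variable {V : Type*} [AddCommGroup V] [Module ℂ V] (O : N2Ops V)

/-- The symmetry exchanging `G^+` and `G^-`. -/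
def swap : N2Ops V where
  L := O.L
  H := fun m => -O.H m
  P := O.Q
  Q := O.P
  LL := O.LL
  LH m n v := by simp only [LinearMap.neg_apply, map_neg, O.LH]; module
  HH m n v := by simp only [LinearMap.neg_apply, map_neg, O.HH m n]
  LP := O.LQ
  LQ := O.LP
  HP m p v := by simp only [LinearMap.neg_apply, map_neg, O.HQ]; module
  HQ m p v := by simp only [LinearMap.neg_apply, map_neg, O.HP]; module
  PP := O.QQ
  QQ := O.PP
  PQ p q v := by
    have := O.PQ q p v
    rw [add_comm q p] at this
    rw [LinearMap.neg_apply, this]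
    module

/-- Stability under the even part. -/
def EvenStable (W : Submodule ℂ V) : Prop := ∀ v ∈ W, ∀ m, O.L m v ∈ W ∧ O.H m v ∈ W

theorem evenStable_opPow {W : Submodule ℂ V} (hW : O.EvenStable W) (i : ℕ) :
    O.EvenStable (opPow O.Q i W) := by
  induction i with
  | zero => exact hW
  | succ i ih =>
    intro v hv m
    constructor
    · refine (opPow_succ_le (W := (opPow O.Q (i + 1) W).comap (O.L m)) fun v hv r => ?_) hv
      rw [Submodule.mem_comap, O.LQ]
      exact add_mem (mem_opPow_succ (ih v hv m).1 r)
        (Submodule.smul_mem _ _ (mem_opPow_succ hv _))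
    · refine (opPow_succ_le (W := (opPow O.Q (i + 1) W).comap (O.H m)) fun v hv r => ?_) hv
      rw [Submodule.mem_comap, O.HQ]
      exact sub_mem (mem_opPow_succ (ih v hv m).2 r) (mem_opPow_succ hv _)

/-- Moving `G^+` to the right past the factors `G^-` until it kills `W` leaves even elements, each
of which has replaced one factor `G^-`. -/
theorem P_opPow_succ {W : Submodule ℂ V} (hW : O.EvenStable W)
    (hP : ∀ v ∈ W, ∀ p, O.P p v = 0) (i : ℕ) :
    ∀ v ∈ opPow O.Q (i + 1) W, ∀ p, O.P p v ∈ opPow O.Q i W := by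
  induction i with
  | zero =>
    intro v hv p
    refine (opPow_succ_le (W := (opPow O.Q 0 W).comap (O.P p)) fun v hv r => ?_) hv
    rw [Submodule.mem_comap, O.PQ, hP v hv p, map_zero, neg_zero, zero_add]
    exact add_mem (Submodule.smul_mem _ _ (hW v hv _).1) (Submodule.smul_mem _ _ (hW v hv _).2)
  | succ i ih =>
    intro v hv p
    refine (opPow_succ_le (W := (opPow O.Q (i + 1) W).comap (O.P p)) fun v hv r => ?_) hv
    have hs := O.evenStable_opPow hW (i + 1) v hv
    rw [Submodule.mem_comap, O.PQ]
    exact add_mem (add_mem (neg_mem (mem_opPow_succ (ih v hv p) r))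
      (Submodule.smul_mem _ _ (hs _).1)) (Submodule.smul_mem _ _ (hs _).2)

/-- The eigenspaces of `H_0`. -/
def level (h : ℂ) (k : ℤ) : Submodule ℂ V := (O.H 0).eigenspace (h + k)

/-- The joint eigenspaces of `L_0` and `H_0`. -/
def wt (lam h : ℂ) (n k : ℤ) : Submodule ℂ V := (O.L 0).eigenspace (lam + n) ⊓ O.level h k

variable {O} {lam h : ℂ} {n k : ℤ} {v : V}

theorem mem_level : v ∈ O.level h k ↔ O.H 0 v = (h + k) • v := Module.End.mem_eigenspace_iff

theorem mem_wt : v ∈ O.wt lam h n k ↔ O.L 0 v = (lam + n) • v ∧ O.H 0 v = (h + k) • v := by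
  rw [wt, Submodule.mem_inf, mem_level, Module.End.mem_eigenspace_iff]

theorem level_independent (O : N2Ops V) (h : ℂ) : iSupIndep (O.level h) :=
  (Module.End.eigenspaces_iSupIndep (O.H 0)).comp (f := fun k : ℤ => h + (k : ℂ))
    fun a b hab => by simpa using hab

theorem L_level (hv : v ∈ O.level h k) (m : ℤ) : O.L m v ∈ O.level h k := by
  rw [mem_level] at hv ⊢
  have := O.LH m 0 v
  rw [hv, map_smul] at this
  simpa using this.symm

theorem H_level (hv : v ∈ O.level h k) (m : ℤ) : O.H m v ∈ O.level h k := by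
  rw [mem_level] at hv ⊢
  rw [O.HH, hv, map_smul]

theorem P_level (hv : v ∈ O.level h k) (m : ℤ) : O.P m v ∈ O.level h (k + 1) := by
  rw [mem_level] at hv ⊢
  rw [O.HP, hv, map_smul, zero_add]; push_cast; module

theorem Q_level (hv : v ∈ O.level h k) (m : ℤ) : O.Q m v ∈ O.level h (k - 1) := by
  rw [mem_level] at hv ⊢
  rw [O.HQ, hv, map_smul, zero_add]; push_cast; module

theorem evenStable_level (O : N2Ops V) (h : ℂ) (k : ℤ) : O.EvenStable (O.level h k) :=
  fun _ hv m => ⟨L_level hv m, H_level hv m⟩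

theorem L_wt (hv : v ∈ O.wt lam h n k) (m : ℤ) : O.L m v ∈ O.wt lam h (n + m) k := by
  refine ⟨Module.End.mem_eigenspace_iff.2 ?_, L_level hv.2 m⟩
  rw [O.LL, (mem_wt.1 hv).1, map_smul, zero_add]; push_cast; module

theorem H_wt (hv : v ∈ O.wt lam h n k) (m : ℤ) : O.H m v ∈ O.wt lam h (n + m) k := by
  refine ⟨Module.End.mem_eigenspace_iff.2 ?_, H_level hv.2 m⟩
  rw [O.LH, (mem_wt.1 hv).1, map_smul, zero_add]; push_cast; module

theorem P_wt (hv : v ∈ O.wt lam h n k) (m : ℤ) : O.P m v ∈ O.wt lam h (n + m) (k + 1) := by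
  refine ⟨Module.End.mem_eigenspace_iff.2 ?_, P_level hv.2 m⟩
  rw [O.LP, (mem_wt.1 hv).1, map_smul, zero_add]; push_cast; module

theorem Q_wt (hv : v ∈ O.wt lam h n k) (m : ℤ) : O.Q m v ∈ O.wt lam h (n + m) (k - 1) := by
  refine ⟨Module.End.mem_eigenspace_iff.2 ?_, Q_level hv.2 m⟩
  rw [O.LQ, (mem_wt.1 hv).1, map_smul, zero_add]; push_cast; module

theorem opPow_le_level {W : Submodule ℂ V} (hW : W ≤ O.level h k) (i : ℕ) :
    opPow O.Q i W ≤ O.level h (k - i) := by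
  induction i with
  | zero => simpa [opPow] using hW
  | succ i ih =>
    refine opPow_succ_le fun v hv r => ?_
    have := Q_level (ih hv) r
    rwa [sub_sub, ← Nat.cast_succ] at this

/-- Simple modules with bounded weight multiplicities. -/
structure IsSimpleBounded (O : N2Ops V) (lam h : ℂ) (N : ℕ) : Prop where
  sup_wt : (⨆ p : ℤ × ℤ, O.wt lam h p.1 p.2) = ⊤
  simple : ∀ W : Submodule ℂ V, O.EvenStable W → (∀ v ∈ W, ∀ p, O.P p v ∈ W ∧ O.Q p v ∈ W) →
    W ≠ ⊥ → W = ⊤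
  finite : ∀ n : ℤ, FiniteDimensional ℂ ((O.L 0).eigenspace (lam + n))
  finrank_le : ∀ n : ℤ, Module.finrank ℂ ((O.L 0).eigenspace (lam + n)) ≤ N

/-! ### Generation by vectors killed by `G^+`, and the bound on the eigenvalues of `H_0`. -/

namespace IsSimpleBounded

variable {N : ℕ}

theorem level_eq (S : O.IsSimpleBounded lam h N) (k : ℤ) :
    O.level h k = ⨆ n, O.wt lam h n k := by
  refine le_antisymm (fun v hv => ?_) (iSup_le fun n => inf_le_right)
  refine (O.level_independent h).mem_of_mem_iSup (A := fun k => ⨆ n, O.wt lam h n k)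
    (fun k => iSup_le fun n => inf_le_right) hv ?_
  rw [iSup_comm, ← iSup_prod (f := fun p : ℤ × ℤ => O.wt lam h p.1 p.2), S.sup_wt]
  trivial

theorem iSup_opPow (S : O.IsSimpleBounded lam h N) {W : Submodule ℂ V} (hW : O.EvenStable W)
    (hP : ∀ v ∈ W, ∀ p, O.P p v = 0) (hne : W ≠ ⊥) : (⨆ i, opPow O.Q i W) = ⊤ := by
  refine S.simple _ (fun v hv m => ?_) (fun v hv p => ?_) fun hbot => hne ?_
  · constructor
    · refine (iSup_le fun i v hv => ?_ : _ ≤ (⨆ i, opPow O.Q i W).comap (O.L m)) hv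
      exact Submodule.mem_iSup_of_mem i (O.evenStable_opPow hW i v hv m).1
    · refine (iSup_le fun i v hv => ?_ : _ ≤ (⨆ i, opPow O.Q i W).comap (O.H m)) hv
      exact Submodule.mem_iSup_of_mem i (O.evenStable_opPow hW i v hv m).2
  · constructor
    · refine (iSup_le fun i v hv => ?_ : _ ≤ (⨆ i, opPow O.Q i W).comap (O.P p)) hv
      cases i with
      | zero => rw [Submodule.mem_comap, hP v hv]; exact zero_mem _
      | succ i => exact Submodule.mem_iSup_of_mem i (O.P_opPow_succ hW hP i v hv p)
    · refine (iSup_le fun i v hv => ?_ : _ ≤ (⨆ i, opPow O.Q i W).comap (O.Q p)) hv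
      exact Submodule.mem_iSup_of_mem (i + 1) (mem_opPow_succ hv p)
  · exact le_bot_iff.1 ((le_iSup (fun i => opPow O.Q i W) 0).trans hbot.le)

/-- The spaces `(G^-)^i W` exhaust the module and lie in the levels `k - i`; independence of the
levels turns the inclusions into equalities and leaves nothing above `k`. -/
theorem level_of_killed (S : O.IsSimpleBounded lam h N) {W : Submodule ℂ V} {k : ℤ}
    (hWk : W ≤ O.level h k) (hW : O.EvenStable W) (hP : ∀ v ∈ W, ∀ p, O.P p v = 0)
    (hne : W ≠ ⊥) :
    (∀ i : ℕ, O.level h (k - i) = opPow O.Q i W) ∧ ∀ j, k < j → O.level h j = ⊥ := by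
  let A : ℤ → Submodule ℂ V := fun j => if j ≤ k then opPow O.Q (k - j).toNat W else ⊥
  have hA : ∀ j, A j ≤ O.level h j := fun j => by
    by_cases hj : j ≤ k
    · have := opPow_le_level hWk (k - j).toNat
      rw [show k - ((k - j).toNat : ℤ) = j by omega] at this
      simpa [A, hj] using this
    · simp [A, hj]
  have hAi : ∀ i : ℕ, A (k - i) = opPow O.Q i W := fun i => by simp [A]
  have htop : (⨆ j, A j) = ⊤ := by
    rw [eq_top_iff, ← S.iSup_opPow hW hP hne]
    exact iSup_le fun i => (hAi i).symm.le.trans (le_iSup A _)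
  have hle : ∀ j, O.level h j ≤ A j := fun j v hv =>
    (O.level_independent h).mem_of_mem_iSup hA hv (by rw [htop]; trivial)
  refine ⟨fun i => le_antisymm ((hle _).trans (hAi i).le) (opPow_le_level hWk i), fun j hj => ?_⟩
  have := hle j
  simpa [A, not_le.2 hj] using this

theorem card_le (S : O.IsSimpleBounded lam h N) (n : ℤ) (t : Finset ℤ)
    (ht : ∀ k ∈ t, O.wt lam h n k ≠ ⊥) : t.card ≤ N := by
  have hex : ∀ k : t, ∃ v ∈ O.wt lam h n k, v ≠ 0 := fun k =>
    Submodule.exists_mem_ne_zero_of_ne_bot (ht k k.2)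
  choose v hv hv0 using hex
  have hli : LinearIndependent ℂ v :=
    Module.End.eigenvectors_linearIndependent' (O.H 0) (fun k : t => h + ((k : ℤ) : ℂ))
      (fun a b hab => Subtype.ext (by simpa using hab)) v fun k => ⟨(hv k).2, hv0 k⟩
  have hli' : LinearIndependent ℂ
      (fun k => (⟨v k, (hv k).1⟩ : (O.L 0).eigenspace (lam + n))) :=
    LinearIndependent.of_comp (Submodule.subtype _) hli
  have := S.finite n
  have := hli'.fintype_card_le_finrank
  simpa using this.trans (S.finrank_le n)

/-- The commutator of `L_{-j}` and `H_j` is `j H_0`, which acts on `v` by the nonzero scalar `j (h +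
k)`; so `H_j v` and `L_{-j} v` cannot both vanish. -/
theorem wt_ne_bot_or (hv : v ∈ O.wt lam h n k) (hv0 : v ≠ 0) (hk : h + k ≠ 0) {j : ℤ}
    (hj : j ≠ 0) : O.wt lam h (n + j) k ≠ ⊥ ∨ O.wt lam h (n - j) k ≠ ⊥ := by
  by_contra! hb
  have h1 : O.H j v = 0 := by simpa [hb.1] using H_wt hv j
  have h2 : O.L (-j) v = 0 := by simpa [← sub_eq_add_neg, hb.2] using L_wt hv (-j)
  have h3 := O.LH (-j) j v
  rw [h1, h2, map_zero, map_zero, zero_add, neg_add_cancel, (mem_wt.1 hv).2, eq_comm,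
    smul_eq_zero, smul_eq_zero] at h3
  rcases h3 with h3 | h3 | h3
  · exact hj (by exact_mod_cast h3)
  · exact hk h3
  · exact hv0 h3

/-- For each `j` from 1 to `R - |n|` one of `n + j`, `n - j` is occupied, and different `j` give
different weights. Thus a level with `h + k ≠ 0` occupies asymptotically at least half of all
weights. -/
theorem le_card_wt (hv : v ∈ O.wt lam h n k) (hv0 : v ≠ 0) (hk : h + k ≠ 0) (R : ℕ)
    [DecidablePred fun a : ℤ => O.wt lam h a k ≠ ⊥] :
    R ≤ ((Finset.Icc (-R : ℤ) R).filter fun a => O.wt lam h a k ≠ ⊥).card + n.natAbs := by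
  rw [← Nat.sub_le_iff_le_add]
  have hc : (Finset.Icc (1 : ℤ) (R - n.natAbs)).card = R - n.natAbs := by rw [Int.card_Icc]; omega
  rw [← hc]
  refine Finset.card_le_card_of_injOn
    (fun j => if O.wt lam h (n + j) k ≠ ⊥ then n + j else n - j) (fun j hj => ?_) ?_
  · simp only [Finset.coe_Icc, Set.mem_Icc] at hj
    have := wt_ne_bot_or hv hv0 hk (j := j) (by omega)
    simp only [Finset.coe_filter, Finset.mem_Icc, Set.mem_ofPred_eq]
    split_ifs with hif
    · exact ⟨by omega, hif⟩
    · exact ⟨by omega, this.resolve_left hif⟩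
  · intro a ha b hb hab
    simp only [Finset.coe_Icc, Set.mem_Icc] at ha hb
    simp only at hab
    split_ifs at hab <;> omega

theorem exists_level_bound (S : O.IsSimpleBounded lam h N) :
    ∃ K : ℤ, ∀ k, K < k → O.level h k = ⊥ := by
  classical
  by_contra! hcon
  have hinf : {k : ℤ | O.level h k ≠ ⊥}.Infinite :=
    Set.infinite_of_forall_exists_gt fun K => by
      obtain ⟨k, hk, hne⟩ := hcon K
      exact ⟨k, hne, hk⟩
  have hfin : {k : ℤ | h + k = 0}.Finite :=
    Set.Subsingleton.finite fun a ha b hb => by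
      simp only [Set.mem_ofPred_eq] at ha hb
      have : (a : ℂ) = b := by rw [← hb] at ha; exact add_left_cancel ha
      exact_mod_cast this
  obtain ⟨s, hs, hcard⟩ := (hinf.sdiff hfin).exists_subset_card_eq (2 * N + 1)
  have hex : ∀ k ∈ s, ∃ n : ℤ, ∃ v ∈ O.wt lam h n k, v ≠ 0 := fun k hk => by
    have hne : O.level h k ≠ ⊥ := (hs hk).1
    rw [S.level_eq, Ne, iSup_eq_bot, not_forall] at hne
    obtain ⟨n, hn⟩ := hne
    obtain ⟨v, hv, hv0⟩ := Submodule.exists_mem_ne_zero_of_ne_bot hn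
    exact ⟨n, v, hv, hv0⟩
  choose! a v hv hv0 using hex
  -- Double counting of the occupied pairs (level, weight) in the window from `-R` to `R`: the `2N +
  -- 1` levels give at least `(2N + 1) R - C` pairs, while each of the `2R + 1` weights meets at
  -- most `N` levels. Hence `R ≤ N + C`, and `R = N + C + 1` is a contradiction.
  set C := ∑ k ∈ s, (a k).natAbs
  set R := N + C + 1
  have h1 : s.card * R ≤
      ∑ k ∈ s, ((Finset.Icc (-R : ℤ) R).filter fun n => O.wt lam h n k ≠ ⊥).card + C := by
    rw [← Finset.sum_add_distrib, ← smul_eq_mul, ← Finset.sum_const]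
    exact Finset.sum_le_sum fun k hk => le_card_wt (hv k hk) (hv0 k hk) (hs hk).2 R
  have h2 := Finset.sum_card_bipartiteAbove_eq_sum_card_bipartiteBelow
    (s := s) (t := Finset.Icc (-R : ℤ) R) (fun k n => O.wt lam h n k ≠ ⊥)
  have h3 : ∑ n ∈ Finset.Icc (-R : ℤ) R, (s.filter fun k => O.wt lam h n k ≠ ⊥).card
      ≤ (Finset.Icc (-R : ℤ) R).card * N :=
    Finset.sum_le_card_nsmul _ _ _ fun n _ => S.card_le n _ fun k hk => (Finset.mem_filter.1 hk).2
  have h4 : (Finset.Icc (-R : ℤ) R).card = 2 * R + 1 := by rw [Int.card_Icc]; omega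
  simp only [Finset.bipartiteAbove, Finset.bipartiteBelow] at h2
  rw [h2] at h1
  rw [h4] at h3
  rw [hcard] at h1
  have h5 := h1.trans (Nat.add_le_add_right h3 C)
  have : R = N + C + 1 := rfl
  nlinarith

end IsSimpleBounded

/-- A simple bounded module for which `h` is the highest eigenvalue of `H_0`. -/
structure IsTop (O : N2Ops V) (lam h : ℂ) (N : ℕ) : Prop extends O.IsSimpleBounded lam h N where
  level_zero : O.level h 0 ≠ ⊥
  level_pos : ∀ k : ℤ, 0 < k → O.level h k = ⊥

namespace IsTop

variable {N : ℕ}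

theorem P_eq_zero (S : O.IsTop lam h N) (hv : v ∈ O.level h 0) (p : ℤ) : O.P p v = 0 := by
  have := P_level hv p
  rwa [S.level_pos _ (by omega), Submodule.mem_bot] at this

theorem level_neg (S : O.IsTop lam h N) {W : Submodule ℂ V} (hWk : W ≤ O.level h 0)
    (hW : O.EvenStable W) (hne : W ≠ ⊥) (i : ℕ) : O.level h (-i) = opPow O.Q i W := by
  have := (S.level_of_killed hWk hW (fun v hv p => S.P_eq_zero (hWk hv) p) hne).1 i
  rwa [zero_sub] at this

theorem eq_level_zero (S : O.IsTop lam h N) {W : Submodule ℂ V} (hWk : W ≤ O.level h 0)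
    (hW : O.EvenStable W) (hne : W ≠ ⊥) : W = O.level h 0 := by
  simpa [opPow] using (S.level_neg hWk hW hne 0).symm

/-- The vectors of level `-1` killed by `G^+` are stable under the even part. Were there a nonzero
one, they would generate the module by `G^-` alone, and level 0 would be empty. -/
theorem eq_zero_of_P_eq_zero (S : O.IsTop lam h N) (hv : v ∈ O.level h (-1))
    (hP : ∀ p, O.P p v = 0) : v = 0 := by
  by_contra hv0
  let W : Submodule ℂ V := O.level h (-1) ⊓ ⨅ p, LinearMap.ker (O.P p)
  have hmem : ∀ w, w ∈ W ↔ w ∈ O.level h (-1) ∧ ∀ p, O.P p w = 0 := fun w => by simp [W]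
  refine S.level_zero ((S.level_of_killed (W := W) (k := -1) inf_le_left (fun w hw m => ?_)
    (fun w hw => ((hmem w).1 hw).2) ?_).2 0 (by norm_num))
  · rw [hmem] at hw
    rw [hmem, hmem]
    refine ⟨⟨L_level hw.1 m, fun p => ?_⟩, H_level hw.1 m, fun p => ?_⟩
    · have := O.LP m p w
      simpa [hw.2] using this.symm
    · have := O.HP m p w
      simpa [hw.2] using this.symm
  · exact fun hb => hv0 (by simpa [hb] using (hmem v).2 ⟨hv, hP⟩)

end IsTop

end N2Ops
-- A finite-dimensional space of sequences and the intermediate series form of the highest level.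
namespace N2Ops

variable {V : Type*} [AddCommGroup V] [Module ℂ V] (O : N2Ops V)

/-- The sequence `n ↦ H_{n-a} u`. -/
def hSeq (a : ℤ) (u : V) : ℤ → V := fun n => O.H (n - a) u

/-- The sequence `n ↦ G^+_n G^-_{-a} u` for `u` killed by `G^+`. -/
def gSeq (a : ℤ) (u : V) : ℤ → V :=
  fun n => (-2 : ℂ) • O.L (n - a) u + ((n : ℂ) + a) • O.H (n - a) u

/-- The operator `t^{-k} H_k` on sequences. -/
def seqX (k : ℤ) : Module.End ℂ (ℤ → V) :=
  LinearMap.pi fun n => O.H k ∘ₗ LinearMap.proj (n - k)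

/-- The operator `t^{-m} L_m` on sequences. -/
def seqY (lam : ℂ) (m : ℤ) : Module.End ℂ (ℤ → V) :=
  LinearMap.pi fun n => O.L m ∘ₗ LinearMap.proj (n - m) - (lam + n - m) • LinearMap.proj n

theorem seqX_apply (k : ℤ) (f : ℤ → V) (n : ℤ) : O.seqX k f n = O.H k (f (n - k)) := rfl

theorem seqY_apply (lam : ℂ) (m : ℤ) (f : ℤ → V) (n : ℤ) :
    O.seqY lam m f n = O.L m (f (n - m)) - (lam + n - m) • f n := rfl

/-- If `f n` has weight `lam + n`, the scalar subtracted in `seqY` is the `L_0`-eigenvalue of `f (n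
- m)`. This replaces `t^m t ∂` by `(t^m - 1) t ∂`. -/
theorem seqY_seqY (lam : ℂ) (m n : ℤ) (f : ℤ → V) :
    O.seqY lam m (O.seqY lam n f) = O.seqY lam n (O.seqY lam m f)
      + ((n : ℂ) - m) • O.seqY lam (m + n) f - (n : ℂ) • O.seqY lam n f
      + (m : ℂ) • O.seqY lam m f := by
  funext b
  simp only [seqY_apply, Pi.add_apply, Pi.sub_apply, Pi.smul_apply, map_sub, map_smul]
  rw [O.LL m n, show b - n - m = b - m - n by ring, show b - (m + n) = b - m - n by ring]
  push_cast
  module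

theorem seqY_seqX (lam : ℂ) (m k : ℤ) (f : ℤ → V) :
    O.seqY lam m (O.seqX k f) = O.seqX k (O.seqY lam m f)
      + (k : ℂ) • (O.seqX (m + k) f - O.seqX k f) := by
  funext b
  simp only [seqY_apply, seqX_apply, Pi.add_apply, Pi.sub_apply, Pi.smul_apply, map_sub, map_smul]
  rw [O.LH m k, show b - k - m = b - m - k by ring, show b - (m + k) = b - m - k by ring]
  push_cast
  module

theorem seqX_hSeq (k a : ℤ) (u : V) : O.seqX k (O.hSeq a u) = O.hSeq (a + k) (O.H k u) := by
  funext n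
  simp only [seqX_apply, hSeq]
  rw [O.HH, show n - k - a = n - (a + k) by ring]

theorem seqX_gSeq (k a : ℤ) (u : V) : O.seqX k (O.gSeq a u) =
    O.gSeq (a + k) (O.H k u) + (2 * k : ℂ) • O.hSeq a u
      - (2 * k : ℂ) • O.hSeq (a + k) (O.H k u) := by
  funext n
  simp only [seqX_apply, hSeq, gSeq, Pi.add_apply, Pi.sub_apply, Pi.smul_apply, map_add, map_smul]
  rw [show n - k - a = n - (a + k) by ring, O.LH (n - (a + k)) k, O.HH k,
    show n - (a + k) + k = n - a by ring]
  push_cast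
  module

theorem seqY_hSeq (lam : ℂ) (m a : ℤ) (u : V) : O.seqY lam m (O.hSeq a u) =
    O.hSeq (a + m) (O.L m u) - (lam + a) • O.hSeq a u := by
  funext n
  simp only [seqY_apply, hSeq, Pi.sub_apply, Pi.smul_apply]
  rw [show n - m - a = n - (a + m) by ring, O.LH, show m + (n - (a + m)) = n - a by ring]
  push_cast
  module

theorem seqY_gSeq (lam : ℂ) (m a : ℤ) (u : V) : O.seqY lam m (O.gSeq a u) =
    O.gSeq (a + m) (O.L m u) - (2 * m : ℂ) • O.hSeq (a + m) (O.L m u)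
      - (lam + a + m) • O.gSeq a u + ((m : ℂ) ^ 2 + 2 * a * m) • O.hSeq a u := by
  funext n
  simp only [seqY_apply, hSeq, gSeq, Pi.add_apply, Pi.sub_apply, Pi.smul_apply, map_add, map_smul]
  rw [show n - m - a = n - (a + m) by ring, O.LH, O.LL m, show m + (n - (a + m)) = n - a by ring]
  push_cast
  module

/-- The span of the sequences attached to the homogeneous vectors of highest `H_0`-eigenvalue. -/
def seqSpan (lam h : ℂ) : Submodule ℂ (ℤ → V) :=
  Submodule.span ℂ {f | ∃ a, ∃ u ∈ O.wt lam h a 0, f = O.hSeq a u ∨ f = O.gSeq a u}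

variable {O} {lam h : ℂ} {n a : ℤ} {u v : V} {N : ℕ}

theorem hSeq_mem (hu : u ∈ O.wt lam h a 0) : O.hSeq a u ∈ O.seqSpan lam h :=
  Submodule.subset_span ⟨a, u, hu, Or.inl rfl⟩

theorem gSeq_mem (hu : u ∈ O.wt lam h a 0) : O.gSeq a u ∈ O.seqSpan lam h :=
  Submodule.subset_span ⟨a, u, hu, Or.inr rfl⟩

theorem seqX_mem (k : ℤ) : ∀ f ∈ O.seqSpan lam h, O.seqX k f ∈ O.seqSpan lam h := by
  suffices O.seqSpan lam h ≤ (O.seqSpan lam h).comap (O.seqX k) from this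
  refine Submodule.span_le.2 ?_
  rintro _ ⟨a, u, hu, rfl | rfl⟩
  · simp only [SetLike.mem_coe, Submodule.mem_comap, seqX_hSeq]
    exact hSeq_mem (H_wt hu k)
  · simp only [SetLike.mem_coe, Submodule.mem_comap, seqX_gSeq]
    exact sub_mem (add_mem (gSeq_mem (H_wt hu k)) (Submodule.smul_mem _ _ (hSeq_mem hu)))
      (Submodule.smul_mem _ _ (hSeq_mem (H_wt hu k)))

theorem seqY_mem (m : ℤ) : ∀ f ∈ O.seqSpan lam h, O.seqY lam m f ∈ O.seqSpan lam h := by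
  suffices O.seqSpan lam h ≤ (O.seqSpan lam h).comap (O.seqY lam m) from this
  refine Submodule.span_le.2 ?_
  rintro _ ⟨a, u, hu, rfl | rfl⟩
  · simp only [SetLike.mem_coe, Submodule.mem_comap, seqY_hSeq]
    exact sub_mem (hSeq_mem (L_wt hu m)) (Submodule.smul_mem _ _ (hSeq_mem hu))
  · simp only [SetLike.mem_coe, Submodule.mem_comap, seqY_gSeq]
    exact add_mem (sub_mem (sub_mem (gSeq_mem (L_wt hu m))
      (Submodule.smul_mem _ _ (hSeq_mem (L_wt hu m)))) (Submodule.smul_mem _ _ (gSeq_mem hu)))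
      (Submodule.smul_mem _ _ (hSeq_mem hu))

theorem apply_mem_wt {f : ℤ → V} (hf : f ∈ O.seqSpan lam h) (n : ℤ) : f n ∈ O.wt lam h n 0 := by
  suffices O.seqSpan lam h ≤ (O.wt lam h n 0).comap (LinearMap.proj n) from this hf
  refine Submodule.span_le.2 ?_
  rintro _ ⟨a, u, hu, rfl | rfl⟩
  · have := H_wt hu (n - a)
    rwa [add_sub_cancel] at this
  · have h1 := H_wt hu (n - a)
    have h2 := L_wt hu (n - a)
    rw [add_sub_cancel] at h1 h2
    exact add_mem (Submodule.smul_mem _ _ h2) (Submodule.smul_mem _ _ h1)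

namespace IsTop

theorem PQ_apply (S : O.IsTop lam h N) (hv : v ∈ O.level h 0) (p q : ℤ) :
    O.P p (O.Q q v) = (-2 : ℂ) • O.L (p + q) v + ((p : ℂ) - q) • O.H (p + q) v := by
  rw [O.PQ, S.P_eq_zero hv, map_zero, neg_zero, zero_add]

/-- For `u` of weight `a` in the highest level, `n ↦ G^+_{n-j} G^-_{j-a} u` equals `gSeq - 2 j
hSeq`. It is also the image of `G^-_{j-a} u`, which lies in the weight space `lam + j` whatever `a`
is. So the pencil `A + j B` has rank at most `N` for every `j`, and both `A` (the case `j = 0`) and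
`B` have finite rank. -/
theorem finiteDimensional_seqSpan (S : O.IsTop lam h N) :
    FiniteDimensional ℂ (O.seqSpan lam h) := by
  let I := {p : ℤ × V // p.2 ∈ O.wt lam h p.1 0}
  let A : (I →₀ ℂ) →ₗ[ℂ] (ℤ → V) := Finsupp.linearCombination ℂ fun i : I => O.gSeq i.1.1 i.1.2
  let B : (I →₀ ℂ) →ₗ[ℂ] (ℤ → V) :=
    Finsupp.linearCombination ℂ fun i : I => (-2 : ℂ) • O.hSeq i.1.1 i.1.2
  let R : ℤ → V →ₗ[ℂ] (ℤ → V) := fun j => LinearMap.pi fun n => O.P (n - j)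
  have hrange : ∀ j : ℤ, LinearMap.range (A + (j : ℂ) • B) ≤
      ((O.L 0).eigenspace (lam + j)).map (R j) := by
    intro j
    rintro _ ⟨d, rfl⟩
    induction d using Finsupp.induction_linear with
    | zero => rw [map_zero]; exact zero_mem _
    | add f g hf hg => rw [map_add]; exact add_mem hf hg
    | single i c =>
      obtain ⟨⟨a, u⟩, hu⟩ := i
      have hQ := (Q_wt hu (j - a)).1
      rw [add_sub_cancel] at hQ
      refine ⟨c • O.Q (j - a) u, Submodule.smul_mem _ _ hQ, funext fun n => ?_⟩
      simp only [R, A, B, LinearMap.pi_apply, map_smul, LinearMap.add_apply, LinearMap.smul_apply,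
        Finsupp.linearCombination_single, Pi.add_apply, Pi.smul_apply, gSeq, hSeq,
        S.PQ_apply hu.2, sub_add_sub_cancel]
      push_cast
      module
  have hpencil : ∀ j : ℤ, FiniteDimensional ℂ (LinearMap.range (A + (j : ℂ) • B)) ∧
      Module.finrank ℂ (LinearMap.range (A + (j : ℂ) • B)) ≤ N := fun j => by
    have := S.finite j
    exact ⟨Submodule.finiteDimensional_of_le (hrange j), (Submodule.finrank_mono (hrange j)).trans
      ((Submodule.finrank_map_le _ _).trans (S.finrank_le j))⟩
  have hB := finiteDimensional_range_of_pencil A B N hpencil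
  have hA : FiniteDimensional ℂ (LinearMap.range A) := by
    have := (hpencil 0).1
    rwa [Int.cast_zero, zero_smul, add_zero] at this
  have hle : O.seqSpan lam h ≤ LinearMap.range A ⊔ LinearMap.range B := by
    refine Submodule.span_le.2 ?_
    rintro _ ⟨a, u, hu, rfl | rfl⟩
    · refine Submodule.mem_sup_right ⟨Finsupp.single ⟨(a, u), hu⟩ (-1 / 2), ?_⟩
      simp only [B, Finsupp.linearCombination_single, smul_smul]
      norm_num
    · refine Submodule.mem_sup_left ⟨Finsupp.single ⟨(a, u), hu⟩ 1, ?_⟩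
      simp only [A, Finsupp.linearCombination_single, one_smul]
  exact Submodule.finiteDimensional_of_le hle

theorem exists_family_of_ne_zero (S : O.IsTop lam h N) (hv : v ∈ O.level h 0) {m : ℤ}
    (hm : O.L m v ≠ 0 ∨ O.H m v ≠ 0) :
    ∃ (u : ℤ → V) (κ : ℂ), u ≠ 0 ∧ (∀ n, u n ∈ O.wt lam h n 0) ∧
      (∀ k n, O.H k (u n) = h • u (n + k)) ∧
      ∀ m n : ℤ, O.L m (u n) = (lam + n + m * κ) • u (n + m) := by
  have hfin := S.finiteDimensional_seqSpan
  have hnt : Nontrivial (O.seqSpan lam h) := by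
    rw [Submodule.nontrivial_iff_ne_bot]
    intro hbot
    have hH : ∀ a, ∀ u ∈ O.wt lam h a 0, ∀ k, O.H k u = 0 := fun a u hu k => by
      have := hSeq_mem hu
      rw [hbot, Submodule.mem_bot] at this
      simpa [hSeq] using congrFun this (a + k)
    have hL : ∀ a, ∀ u ∈ O.wt lam h a 0, ∀ k, O.L k u = 0 := fun a u hu k => by
      have := gSeq_mem hu
      rw [hbot, Submodule.mem_bot] at this
      simpa [gSeq, hH a u hu] using congrFun this (a + k)
    have hle : O.level h 0 ≤ LinearMap.ker (O.L m) ⊓ LinearMap.ker (O.H m) := by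
      rw [S.level_eq]
      exact iSup_le fun a u hu => ⟨hL a u hu m, hH a u hu m⟩
    rcases hm with hm | hm
    · exact hm (hle hv).1
    · exact hm (hle hv).2
  -- A common eigenvector with `x k f = h f` and `y m f = m κ f` is, read termwise, exactly a family
  -- of intermediate series type.
  have W : PointedWitt (fun k => (O.seqX k).restrict (seqX_mem (lam := lam) (h := h) k))
      (fun m => (O.seqY lam m).restrict (seqY_mem (lam := lam) (h := h) m)) h :=
    { yy := fun m n f => Subtype.ext (O.seqY_seqY lam m n f)
      yx := fun m k f => Subtype.ext (O.seqY_seqX lam m k f)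
      y_zero := fun f => Subtype.ext <| funext fun n => by
        simp [seqY_apply, (mem_wt.1 (apply_mem_wt f.2 n)).1]
      x_zero := fun f => Subtype.ext <| funext fun n => by
        simp [seqX_apply, (mem_wt.1 (apply_mem_wt f.2 n)).2] }
  obtain ⟨f, κ, hf0, hx, hy⟩ := W.exists_common_eigenvector
  refine ⟨f, κ, fun h0 => hf0 (Subtype.ext h0), apply_mem_wt f.2, fun k n => ?_, fun m n => ?_⟩
  · have := congrFun (congrArg Subtype.val (hx k)) (n + k)
    simpa [seqX_apply] using this
  · have := congrFun (congrArg Subtype.val (hy m)) (n + m)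
    simp only [LinearMap.coe_restrict_apply, seqY_apply, add_sub_cancel_right, SetLike.val_smul,
      Pi.smul_apply, sub_eq_iff_eq_add] at this
    rw [this]; push_cast; module

theorem exists_family (S : O.IsTop lam h N) :
    ∃ (u : ℤ → V) (κ : ℂ), u ≠ 0 ∧ (∀ n, u n ∈ O.wt lam h n 0) ∧
      (∀ k n, O.H k (u n) = h • u (n + k)) ∧
      ∀ m n : ℤ, O.L m (u n) = (lam + n + m * κ) • u (n + m) := by
  by_cases hne : ∃ v ∈ O.level h 0, ∃ m, O.L m v ≠ 0 ∨ O.H m v ≠ 0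
  · obtain ⟨v, hv, m, hm⟩ := hne
    exact S.exists_family_of_ne_zero hv hm
  · push Not at hne
    have h0 := S.level_zero
    rw [S.level_eq, Ne, iSup_eq_bot, not_forall] at h0
    obtain ⟨a, ha⟩ := h0
    obtain ⟨v, hv, hv0⟩ := Submodule.exists_mem_ne_zero_of_ne_bot ha
    have hz := hne v hv.2
    have hlam : lam + a = 0 := by
      have := (mem_wt.1 hv).1
      rw [(hz 0).1, eq_comm, smul_eq_zero] at this
      exact this.resolve_right hv0
    have hh : h = 0 := by
      have := (mem_wt.1 hv).2
      rw [(hz 0).2, eq_comm, smul_eq_zero] at this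
      simpa using this.resolve_right hv0
    -- The even part kills `v`, which forces `lam + a = 0` and `h = 0`. With `κ = 1` the coefficient
    -- `lam + n + m` vanishes exactly where `u (n + m)` does not.
    refine ⟨Pi.single a v, 1, by simpa using hv0, fun n => ?_, fun k n => ?_, fun m n => ?_⟩
    · by_cases hn : n = a
      · subst hn; simpa using hv
      · simp [hn]
    · by_cases hn : n = a
      · subst hn; simp [hz, hh]
      · simp [hn, hh]
    · have h1 : O.L m (Pi.single (M := fun _ => V) a v n) = 0 := by
        by_cases hn : n = a
        · subst hn; simp [hz]
        · simp [hn]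
      rw [h1]
      by_cases hn : n + m = a
      · subst hn
        push_cast at hlam
        rw [mul_one, add_assoc, hlam, zero_smul]
      · simp [hn]

end IsTop

end N2Ops
-- Explicit form of the levels, the symmetry of `G^+` and `G^-`, and the depth.
namespace N2Ops

variable {V : Type*} [AddCommGroup V] [Module ℂ V] {O : N2Ops V}
  {lam h : ℂ} {n : ℤ} {v : V} {N : ℕ}

namespace IsTop

theorem wt_le_of_level_le (A : ℤ → Submodule ℂ V) {k : ℤ} (hA : ∀ n, A n ≤ O.wt lam h n k)
    (hle : O.level h k ≤ ⨆ n, A n) (n : ℤ) : O.wt lam h n k ≤ A n := fun _ hv =>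
  ((Module.End.eigenspaces_iSupIndep (O.L 0)).comp (f := fun n : ℤ => lam + (n : ℂ))
    fun a b hab => by simpa using hab).mem_of_mem_iSup (A := A)
    (fun n => (hA n).trans inf_le_left) hv.1 (hle hv.2)

theorem level_neg_self (S : O.IsTop lam h N) (i : ℕ) :
    O.level h (-i) = opPow O.Q i (O.level h 0) :=
  S.level_neg le_rfl (O.evenStable_level h 0) S.level_zero i

theorem level_eq_bot_of_le (S : O.IsTop lam h N) {i j : ℕ} (hij : i ≤ j)
    (hi : O.level h (-i) = ⊥) : O.level h (-j) = ⊥ := by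
  obtain ⟨k, rfl⟩ := Nat.exists_eq_add_of_le hij
  clear hij
  induction k with
  | zero => exact hi
  | succ k ih =>
    rw [level_neg_self S] at ih ⊢
    rw [← add_assoc, opPow, ih]
    simp

/-- The explicit form of a simple bounded module. -/
theorem exists_basis (S : O.IsTop lam h N) :
    ∃ u w z y : ℤ → V,
      (∀ n, u n ∈ O.wt lam h n 0) ∧ (∀ n, w n ∈ O.wt lam h n (-1)) ∧
      (∀ n, z n ∈ O.wt lam h n (-1)) ∧ (∀ n, y n ∈ O.wt lam h n (-2)) ∧
      (∀ k n, O.H k (u n) = h • u (n + k)) ∧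
      (O.level h 0 = ⨆ n, Submodule.span ℂ {u n}) ∧
      (∀ q n, O.Q q (u n) = w (n + q) + (q : ℂ) • z (n + q)) ∧
      (∀ p q n, O.Q p (O.Q q (u n)) = ((q : ℂ) - p) • y (n + q + p)) ∧
      ∀ r n, O.Q r (y n) = 0 := by
  obtain ⟨u, κ, hu0, hu, huH, huL⟩ := S.exists_family
  let w : ℤ → V := fun n => O.Q 0 (u n)
  let z : ℤ → V := fun n => O.Q 1 (u (n - 1)) - O.Q 0 (u n)
  have hw : ∀ n, w n ∈ O.wt lam h n (-1) := fun n => by simpa using Q_wt (hu n) 0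
  have hz : ∀ n, z n ∈ O.wt lam h n (-1) := fun n =>
    sub_mem (by simpa using Q_wt (hu (n - 1)) 1) (by simpa using Q_wt (hu n) 0)
  have hPQ : ∀ p q n, O.P p (O.Q q (u n)) =
      (-2 * (lam + n + (p + q) * κ) + (p - q) * h) • u (n + p + q) := fun p q n => by
    rw [S.PQ_apply (hu n).2, huL, huH, ← add_assoc]
    push_cast
    module
  -- For fixed `n + q` the scalar in `hPQ` is affine in `q`. Since `G^+` detects the vectors of
  -- level `-1`, `G^-_q u_n` is itself affine in `q`, and `w`, `z` interpolate it from `q = 0` and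
  -- `q = 1`.
  have hQ : ∀ q n, O.Q q (u n) = w (n + q) + (q : ℂ) • z (n + q) := fun q n => by
    rw [← sub_eq_zero]
    refine S.eq_zero_of_P_eq_zero ?_ fun p => ?_
    · refine sub_mem ?_ (add_mem (hw _).2 (Submodule.smul_mem _ _ (hz _).2))
      simpa using Q_level (hu n).2 q
    · simp only [w, z, map_sub, map_add, map_smul, hPQ]
      rw [show n + q + p + 0 = n + p + q by ring, show n + q - 1 + p + 1 = n + p + q by ring]
      push_cast
      module
  have hQQ : ∀ p q s, O.Q p (O.Q q (u (s - p - q))) =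
      O.Q p (w (s - p)) + (q : ℂ) • O.Q p (z (s - p)) := fun p q s => by
    rw [hQ, map_add, map_smul, sub_add_cancel]
  have hsq : ∀ p v, O.Q p (O.Q p v) = 0 := fun p v => by
    have := O.QQ p p v
    rw [eq_neg_iff_add_eq_zero, ← two_smul ℂ] at this
    simpa using this
  have hw' : ∀ p s, O.Q p (w (s - p)) = -(p : ℂ) • O.Q p (z (s - p)) := fun p s => by
    have := hQQ p p s
    rw [hsq] at this
    rw [neg_smul]
    exact eq_neg_of_add_eq_zero_left this.symm
  have hQQ' : ∀ p q s, O.Q p (O.Q q (u (s - p - q))) =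
      ((q : ℂ) - p) • O.Q p (z (s - p)) := fun p q s => by
    rw [hQQ, hw']; module
  let y : ℤ → V := fun n => O.Q 0 (z n)
  -- Anticommutation of `G^-_0` and `G^-_p` makes the value independent of `p`.
  have hyz : ∀ p s, O.Q p (z (s - p)) = y s := fun p s => by
    by_cases hp : p = 0
    · subst hp; simp [y]
    · have h1 := hQQ' p 0 s
      have h2 := hQQ' 0 p s
      rw [O.QQ, sub_right_comm, h2, ← smul_neg, ← sub_eq_zero] at h1
      have h3 : (p : ℂ) • (O.Q p (z (s - p)) - O.Q 0 (z (s - 0))) = 0 := by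
        rw [← h1]; push_cast; module
      have h4 := (smul_eq_zero.1 h3).resolve_left (by exact_mod_cast hp)
      rw [sub_eq_zero.1 h4, sub_zero]
  have hQy : ∀ p q n, O.Q p (O.Q q (u n)) = ((q : ℂ) - p) • y (n + q + p) := fun p q n => by
    have := hQQ' p q (n + q + p)
    rwa [hyz, add_sub_cancel_right, add_sub_cancel_right] at this
  refine ⟨u, w, z, y, hu, hw, hz, fun n => by simpa using Q_wt (hz n) 0, huH, ?_, hQ, hQy,
    fun r n => ?_⟩
  · symm
    refine S.eq_level_zero (iSup_le fun n => ?_) ?_ ?_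
    · rw [Submodule.span_singleton_le_iff_mem]
      exact (hu n).2
    · have hmem : ∀ n, u n ∈ ⨆ n, Submodule.span ℂ {u n} := fun n =>
        Submodule.mem_iSup_of_mem n (Submodule.mem_span_singleton_self _)
      intro v hv m
      constructor
      · refine (iSup_le fun n => ?_ :
          _ ≤ (⨆ n, Submodule.span ℂ {u n}).comap (O.L m)) hv
        rw [Submodule.span_singleton_le_iff_mem, Submodule.mem_comap, huL]
        exact Submodule.smul_mem _ _ (hmem _)
      · refine (iSup_le fun n => ?_ :
          _ ≤ (⨆ n, Submodule.span ℂ {u n}).comap (O.H m)) hv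
        rw [Submodule.span_singleton_le_iff_mem, Submodule.mem_comap, huH]
        exact Submodule.smul_mem _ _ (hmem _)
    · intro hbot
      refine hu0 (funext fun n => ?_)
      rw [iSup_eq_bot] at hbot
      simpa using hbot n
  · have h1 := hQy (r + 1) r (n - r - (r + 1))
    have h2 : O.Q r (O.Q (r + 1) (O.Q r (u (n - r - (r + 1))))) = 0 := by
      rw [O.QQ r (r + 1), hsq, map_zero, neg_zero]
    rw [h1, map_smul, show n - r - (r + 1) + r + (r + 1) = n by ring, smul_eq_zero] at h2
    refine h2.resolve_left ?_
    push_cast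
    norm_num

/-- The first four parts read off the spanning families `u`, `{w, z}`, `y`. If `h ≠ 0`, each `u_m`
is a multiple of `H_{m-n} u_n`, so one empty weight would empty the whole highest level. -/
theorem finrank_wt_le (S : O.IsTop lam h N) :
    (∀ n, Module.finrank ℂ (O.wt lam h n 0) ≤ 1) ∧
    (∀ n, Module.finrank ℂ (O.wt lam h n (-1)) ≤ 2) ∧
    (∀ n, Module.finrank ℂ (O.wt lam h n (-2)) ≤ 1) ∧
    O.level h (-3) = ⊥ ∧ (h ≠ 0 → ∀ n, O.wt lam h n 0 ≠ ⊥) := by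
  classical
  obtain ⟨u, w, z, y, hu, hw, hz, hy, huH, hlev, hQ, hQQ, hQy⟩ := S.exists_basis
  have l1 : opPow O.Q 1 (O.level h 0) ≤ ⨆ n, Submodule.span ℂ {w n, z n} := by
    refine opPow_succ_le fun v hv r => ?_
    change v ∈ O.level h 0 at hv
    rw [hlev] at hv
    refine (iSup_le fun n => ?_ :
      _ ≤ (⨆ n, Submodule.span ℂ {w n, z n}).comap (O.Q r)) hv
    rw [Submodule.span_singleton_le_iff_mem, Submodule.mem_comap, hQ]
    refine Submodule.mem_iSup_of_mem (n + r) ?_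
    exact add_mem (Submodule.subset_span (by simp))
      (Submodule.smul_mem _ _ (Submodule.subset_span (by simp)))
  have l2 : opPow O.Q 2 (O.level h 0) ≤ ⨆ n, Submodule.span ℂ {y n} := by
    refine opPow_succ_le fun v hv r => ?_
    refine (opPow_succ_le (i := 0)
      (W := (⨆ n, Submodule.span ℂ {y n}).comap (O.Q r)) fun v hv q => ?_) hv
    change v ∈ O.level h 0 at hv
    rw [hlev] at hv
    refine (iSup_le fun n => ?_ :
      _ ≤ ((⨆ n, Submodule.span ℂ {y n}).comap (O.Q r)).comap (O.Q q)) hv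
    rw [Submodule.span_singleton_le_iff_mem, Submodule.mem_comap, Submodule.mem_comap, hQQ]
    exact Submodule.mem_iSup_of_mem _
      (Submodule.smul_mem _ _ (Submodule.mem_span_singleton_self _))
  have l3 : opPow O.Q 3 (O.level h 0) ≤ ⊥ := by
    refine opPow_succ_le fun v hv r => ?_
    refine (iSup_le fun n => ?_ : _ ≤ (⊥ : Submodule ℂ V).comap (O.Q r)) (l2 hv)
    rw [Submodule.span_singleton_le_iff_mem, Submodule.mem_comap, hQy]
    exact zero_mem _
  refine ⟨fun n => ?_, fun n => ?_, fun n => ?_, ?_, fun hh n hbot => ?_⟩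
  · have := wt_le_of_level_le (fun n => Submodule.span ℂ {u n})
      (fun n => (Submodule.span_singleton_le_iff_mem _ _).2 (hu n)) hlev.le n
    exact (Submodule.finrank_mono this).trans (by simpa using finrank_span_le_card {u n})
  · have := wt_le_of_level_le (fun n => Submodule.span ℂ {w n, z n})
      (fun n => Submodule.span_le.2 (Set.pair_subset (hw n) (hz n)))
      ((S.level_neg_self 1).le.trans l1) n
    have hf : FiniteDimensional ℂ (Submodule.span ℂ {w n, z n}) :=
      FiniteDimensional.span_of_finite ℂ (Set.toFinite _)
    refine (Submodule.finrank_mono this).trans ((finrank_span_le_card {w n, z n}).trans ?_)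
    simpa using Finset.card_le_two (a := w n) (b := z n)
  · have := wt_le_of_level_le (fun n => Submodule.span ℂ {y n})
      (fun n => (Submodule.span_singleton_le_iff_mem _ _).2 (hy n))
      ((S.level_neg_self 2).le.trans l2) n
    exact (Submodule.finrank_mono this).trans (by simpa using finrank_span_le_card {y n})
  · exact le_bot_iff.1 ((S.level_neg_self 3).le.trans l3)
  · have hun : u n = 0 := by simpa [hbot] using hu n
    refine S.level_zero (hlev.trans (iSup_eq_bot.2 fun m => ?_))
    have := huH (m - n) n
    rw [hun, map_zero, add_sub_cancel, eq_comm, smul_eq_zero] at this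
    simp [this.resolve_left hh]

end IsTop

/-- Exchanging `G^+` and `G^-` negates `H_0`. The shift `i` chooses which level becomes level 0;
with `i = d` it is the lowest one. -/
theorem swap_level (h : ℂ) (i k : ℤ) : O.swap.level (-h + i) k = O.level h (-i - k) := by
  ext v
  rw [mem_level, mem_level]
  change -(O.H 0 v) = _ ↔ _
  rw [neg_eq_iff_eq_neg]
  push_cast
  rw [show -((-h + i + k) • v) = (h + (-i - k) : ℂ) • v by module]

theorem swap_wt (lam h : ℂ) (i n k : ℤ) :
    O.swap.wt lam (-h + i) n k = O.wt lam h n (-i - k) := by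
  rw [wt, swap_level]; rfl

theorem IsSimpleBounded.swap (S : O.IsSimpleBounded lam h N) (i : ℤ) :
    O.swap.IsSimpleBounded lam (-h + i) N where
  sup_wt := by
    rw [eq_top_iff, ← S.sup_wt]
    refine iSup_le fun p => le_iSup_of_le (p.1, -i - p.2) ?_
    rw [swap_wt]
    simp
  simple W hE hW hne := by
    refine S.simple W (fun v hv m => ⟨(hE v hv m).1, ?_⟩) (fun v hv p => (hW v hv p).symm) hne
    simpa [N2Ops.swap] using neg_mem (hE v hv m).2
  finite := S.finite
  finrank_le := S.finrank_le

/-- A simple bounded module whose `H_0`-eigenvalues are `h, h - 1, …, h - d`. -/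
structure HasDepth (O : N2Ops V) (lam h : ℂ) (N d : ℕ) : Prop extends O.IsTop lam h N where
  level_bottom : O.level h (-d) ≠ ⊥
  level_below : ∀ k : ℤ, k < -d → O.level h k = ⊥

theorem IsTop.exists_hasDepth (S : O.IsTop lam h N) : ∃ d ≤ 2, O.HasDepth lam h N d := by
  classical
  have hex : ∃ i : ℕ, O.level h (-i) = ⊥ := ⟨3, S.finrank_wt_le.2.2.2.1⟩
  have h0 : Nat.find hex ≠ 0 := fun hz => S.level_zero (by simpa [hz] using Nat.find_spec hex)
  have h3 : Nat.find hex ≤ 3 := Nat.find_min' hex S.finrank_wt_le.2.2.2.1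
  -- The depth is one less than the first `i` for which the level `-i` is empty; that `i` lies
  -- between 1 and 3.
  refine ⟨Nat.find hex - 1, by omega, S, Nat.find_min hex (by omega), fun k hk => ?_⟩
  have := S.level_eq_bot_of_le (i := Nat.find hex) (j := (-k).toNat) (by omega) (Nat.find_spec hex)
  rwa [show -((-k).toNat : ℤ) = k by omega] at this

namespace HasDepth

variable {d : ℕ}

theorem swap (S : O.HasDepth lam h N d) : O.swap.HasDepth lam (-h + (d : ℤ)) N d where
  toIsSimpleBounded := S.toIsSimpleBounded.swap d
  level_zero := by rw [swap_level, sub_zero]; exact S.level_bottom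
  level_pos k hk := by rw [swap_level]; exact S.level_below _ (by omega)
  level_bottom := by rw [swap_level]; simpa using S.level_zero
  level_below k hk := by rw [swap_level]; exact S.level_pos _ (by omega)

theorem opPow_P (S : O.HasDepth lam h N d) (i : ℕ) :
    opPow O.P i (O.level h (-d)) = O.level h (-d + i) := by
  have := S.swap.level_neg_self i
  rw [swap_level, swap_level, sub_neg_eq_add, sub_zero] at this
  exact this.symm

theorem opPow_Q_eq_opPow_P (S : O.HasDepth lam h N d) {i : ℕ} (hi : i ≤ d) :
    opPow O.Q i (O.level h 0) = opPow O.P (d - i) (O.level h (-d)) := by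
  rw [S.opPow_P, ← S.level_neg_self]
  congr 1
  omega

theorem iSup_level (S : O.HasDepth lam h N d) :
    (⨆ i ∈ Finset.range (d + 1), O.level h (-(i : ℤ))) = ⊤ := by
  rw [eq_top_iff, ← S.sup_wt]
  refine iSup_le fun p => inf_le_right.trans ?_
  by_cases hp : p.2 ≤ 0 ∧ -(d : ℤ) ≤ p.2
  · refine le_iSup₂_of_le (-p.2).toNat (by rw [Finset.mem_range]; omega) ?_
    rw [show -((-p.2).toNat : ℤ) = p.2 by omega]
  · rw [not_and_or] at hp
    rcases hp with hp | hp
    · rw [S.level_pos _ (by omega)]; exact bot_le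
    · rw [S.level_below _ (by omega)]; exact bot_le

theorem iSup_opPow_Q (S : O.HasDepth lam h N d) :
    (⨆ i ∈ Finset.range (d + 1), opPow O.Q i (O.level h 0)) = ⊤ := by
  rw [← S.iSup_level]
  exact iSup_congr fun i => iSup_congr fun _ => (S.level_neg_self i).symm

theorem iSup_opPow_P (S : O.HasDepth lam h N d) :
    (⨆ i ∈ Finset.range (d + 1), opPow O.P i (O.level h (-d))) = ⊤ := by
  have := S.swap.iSup_opPow_Q
  rwa [swap_level, sub_zero] at this

theorem finrank_bottom_le (S : O.HasDepth lam h N d) (n : ℤ) :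
    Module.finrank ℂ (O.wt lam h n (-d)) ≤ 1 := by
  have := S.swap.finrank_wt_le.1 n
  rwa [swap_wt, sub_zero] at this

/-- If `h ≠ 0` the highest level meets every weight. If `h = 0` the lowest level does, since after
the exchange of `G^+` and `G^-` its `H_0`-eigenvalue is `d ≠ 0`. -/
theorem exists_wt_ne_bot (S : O.HasDepth lam h N d) (hd : d ≠ 0) :
    ∃ n, O.wt lam h n 0 ≠ ⊥ ∧ O.wt lam h n (-d) ≠ ⊥ := by
  have hex : ∀ k, O.level h k ≠ ⊥ → ∃ n, O.wt lam h n k ≠ ⊥ := fun k hk => by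
    rwa [S.level_eq, Ne, iSup_eq_bot, not_forall] at hk
  by_cases hh : h = 0
  · obtain ⟨n, hn⟩ := hex 0 S.level_zero
    refine ⟨n, hn, ?_⟩
    have := S.swap.finrank_wt_le.2.2.2.2 (by simpa [hh] using hd) n
    rwa [swap_wt, sub_zero] at this
  · obtain ⟨n, hn⟩ := hex _ S.level_bottom
    exact ⟨n, S.finrank_wt_le.2.2.2.2 hh n, hn⟩

/-- Depth zero means that the algebra acts as zero. -/
theorem eq_zero (S : O.HasDepth lam h N 0) (m : ℤ) (v : V) :
    O.L m v = 0 ∧ O.H m v = 0 ∧ O.P m v = 0 ∧ O.Q m v = 0 := by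
  have htop : O.level h 0 = ⊤ := by simpa using S.iSup_level
  have hv : ∀ v, v ∈ O.level h 0 := fun v => by rw [htop]; trivial
  have hP : ∀ m v, O.P m v = 0 := fun m v => S.P_eq_zero (hv v) m
  have hQ : ∀ m v, O.Q m v = 0 := fun m v => by
    have := Q_level (hv v) m
    rwa [S.level_below _ (by simp), Submodule.mem_bot] at this
  -- The relations for `(0, m)` and `(1, m - 1)` contain the same `L_m` and differ by `2 H_m`.
  have h0 := O.PQ 0 m v
  have h1 := O.PQ 1 (m - 1) v
  simp only [hP, hQ, zero_add, neg_zero, add_sub_cancel] at h0 h1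
  have hH : O.H m v = 0 := by
    have : (2 : ℂ) • O.H m v = 0 := by
      rw [← sub_self (0 : V)]
      nth_rewrite 1 [h1]
      rw [h0]
      push_cast
      module
    simpa using this
  rw [hH, smul_zero, add_zero, eq_comm, smul_eq_zero] at h0
  exact ⟨h0.resolve_left (by norm_num), hH, hP m v, hQ m v⟩

end HasDepth

end N2Ops
-- Vanishing of the central charge.
section Heisenberg

/-- Multiplying `b ^ (m + 1) * x = 0` by `a` on the left gives `(m + 1) γ b ^ m x = 0`, so the
powers of `b` can be stripped one at a time. -/
theorem eq_zero_of_pow_mul_eq_zero {A : Type*} [Ring A] [Algebra ℂ A] {a b x : A} {γ : ℂ}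
    (hγ : γ ≠ 0) (hab : a * b = b * a + algebraMap ℂ A γ) (hax : a * x = x * a) (m : ℕ)
    (h : b ^ m * x = 0) : x = 0 := by
  have hpow : ∀ m : ℕ, a * b ^ (m + 1) = b ^ (m + 1) * a + algebraMap ℂ A ((m + 1) * γ) * b ^ m := by
    intro m
    induction m with
    | zero => simp [hab]
    | succ m ih =>
      rw [pow_succ b (m + 1), ← mul_assoc, ih, add_mul, mul_assoc, hab, mul_add, mul_assoc _ _ b,
        ← pow_succ, ← (Algebra.commutes γ (b ^ (m + 1))), mul_assoc, add_assoc, ← add_mul, ← map_add]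
      congr 3
      push_cast
      ring
  induction m with
  | zero => simpa using h
  | succ m ih =>
    refine ih ?_
    have h1 : a * (b ^ (m + 1) * x) = 0 := by rw [h, mul_zero]
    rw [← mul_assoc, hpow, add_mul, mul_assoc, hax, ← mul_assoc, h, zero_mul, zero_add, mul_assoc,
      ← Algebra.smul_def, smul_eq_zero] at h1
    exact h1.resolve_left (mul_ne_zero (by exact_mod_cast Nat.succ_ne_zero m) hγ)

/-- The powers of `T` are eigenvectors of the commutator with `e` for the distinct eigenvalues `k
γ`. If `T ^ (N * N)` were nonzero, the exponents from 0 to `N * N` would give too many independent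
endomorphisms. -/
theorem pow_eq_zero_of_commutator_eq_smul {V : Type*} [AddCommGroup V] [Module ℂ V]
    [FiniteDimensional ℂ V] {N : ℕ} (hN : Module.finrank ℂ V ≤ N) {e T : Module.End ℂ V} {γ : ℂ}
    (hγ : γ ≠ 0) (h : e * T = T * e + γ • T) : T ^ (N * N) = 0 := by
  by_contra hne
  have hpow : ∀ k : ℕ, e * T ^ k = T ^ k * e + (k * γ) • T ^ k := by
    intro k
    induction k with
    | zero => simp
    | succ k ih =>
      rw [pow_succ, ← mul_assoc, ih, add_mul, mul_assoc, h, mul_add, smul_mul_assoc, mul_smul_comm,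
        mul_assoc, add_assoc, ← add_smul]
      push_cast
      congr 2
      ring
  let ad : Module.End ℂ (Module.End ℂ V) := LinearMap.mulLeft ℂ e - LinearMap.mulRight ℂ e
  have hli := Module.End.eigenvectors_linearIndependent' ad
    (fun k : Fin (N * N + 1) => ((k : ℕ) : ℂ) * γ)
    (fun a b hab => Fin.ext (by
      have := mul_right_cancel₀ hγ hab
      exact_mod_cast this)) (fun k => T ^ (k : ℕ)) fun k => ⟨by
        rw [Module.End.mem_eigenspace_iff]
        simp [ad, hpow], fun h0 => hne (pow_eq_zero_of_le (Nat.lt_succ_iff.1 k.2) h0)⟩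
  have h1 := hli.fintype_card_le_finrank
  rw [Module.finrank_linearMap, Fintype.card_fin] at h1
  have := Nat.mul_le_mul hN hN
  omega

/-- A representation of the Heisenberg algebra with bounded multiplicities has central charge
zero. -/
theorem heisenberg_charge_eq_zero {V : Type*} [AddCommGroup V] [Module ℂ V] [Nontrivial V]
    {ι : Type*} (E : ι → Submodule ℂ V) (hE : ⨆ i, E i = ⊤) (N : ℕ)
    (hfin : ∀ i, FiniteDimensional ℂ (E i) ∧ Module.finrank ℂ (E i) ≤ N)
    {a b p q : Module.End ℂ V} {γ : ℂ} (hab : a * b = b * a + algebraMap ℂ _ γ)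
    (hpq : q * p = p * q + algebraMap ℂ _ (-(2 * γ))) (hap : a * p = p * a) (hbp : b * p = p * b)
    (hT : ∀ i, ∀ v ∈ E i, (b * b * p) v ∈ E i) (he : ∀ i, ∀ v ∈ E i, (a * b) v ∈ E i) : γ = 0 := by
  by_contra hγ
  -- For `a, b, p = H_1, H_{-1}, H_2` the product `b * b * p` has degree zero, so it preserves the
  -- weight spaces, and it is an eigenvector for the commutator with `a * b`. The exponent `N * N`
  -- is the same on all weight spaces, so `b * b * p` is nilpotent on `V`. Stripping the powers of
  -- `b` by `a` and those of `p` by `q` then leads to `1 = 0`.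
  have hcomm : a * b * (b * b * p) = b * b * p * (a * b) + (2 * γ) • (b * b * p) := by
    have h1 : a * b * (b * b * p) = a * b * b * p * b := by
      rw [mul_assoc b b p, hbp]
      simp only [mul_assoc]
    have h2 : b * b * p * (a * b) = b * b * a * p * b := by
      simp only [mul_assoc]
      rw [← mul_assoc p a b, ← hap, mul_assoc]
    have h3 : a * b * b = b * b * a + (2 * γ) • b := by
      rw [hab, add_mul, mul_assoc, hab, mul_add, ← Algebra.commutes, ← Algebra.smul_def]
      rw [mul_assoc]
      module
    rw [h1, h2, h3, add_mul, add_mul, smul_mul_assoc, smul_mul_assoc, mul_assoc b p b, ← hbp,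
      ← mul_assoc]
  have hnil : (b * b * p) ^ (N * N) = 0 := by
    rw [← LinearMap.ker_eq_top, eq_top_iff, ← hE]
    refine iSup_le fun i v hv => ?_
    have := (hfin i).1
    have h1 := pow_eq_zero_of_commutator_eq_smul (hfin i).2 (mul_ne_zero two_ne_zero hγ)
      (e := (a * b).restrict (he i)) (T := (b * b * p).restrict (hT i))
      (LinearMap.ext fun w => Subtype.ext (LinearMap.congr_fun hcomm w))
    rw [Module.End.pow_restrict] at h1
    exact congrArg Subtype.val (LinearMap.congr_fun h1 ⟨v, hv⟩)
  have hbp' : Commute (b * b) p := Commute.mul_left hbp hbp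
  rw [hbp'.mul_pow, ← pow_two, ← pow_mul] at hnil
  have hp := eq_zero_of_pow_mul_eq_zero hγ hab ((show Commute a p from hap).pow_right _) _ hnil
  rw [← mul_one (p ^ _)] at hp
  exact one_ne_zero (eq_zero_of_pow_mul_eq_zero (neg_ne_zero.2 (mul_ne_zero two_ne_zero hγ)) hpq
    (by simp) _ hp)

end Heisenberg
-- From graded modules to operators; the action of the centre.
section Grading

variable {V : Type*} [AddCommGroup V] [Module ℂ V]

theorem iSup_zmod_two (A : ZMod 2 → Submodule ℂ V) : ⨆ τ, A τ = A 0 ⊔ A 1 := by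
  refine le_antisymm (iSup_le fun τ => ?_) (sup_le (le_iSup A 0) (le_iSup A 1))
  obtain rfl | rfl : τ = 0 ∨ τ = 1 := by revert τ; decide
  exacts [le_sup_left, le_sup_right]

theorem eigenspace_le_iSup_inf {G : ZMod 2 → Submodule ℂ V} (hG : iSupIndep G)
    (htop : ⨆ τ, G τ = ⊤) {T : Module.End ℂ V} (hT : ∀ τ, ∀ v ∈ G τ, T v ∈ G τ) (μ : ℂ) :
    T.eigenspace μ ≤ ⨆ τ, T.eigenspace μ ⊓ G τ := by
  intro v hv
  have hv' : v ∈ ⨆ τ, G τ := by rw [htop]; trivial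
  rw [iSup_zmod_two] at hv'
  obtain ⟨x, hx, y, hy, rfl⟩ := Submodule.mem_sup.1 hv'
  have hdisj : Disjoint (G 0) (G 1) := hG.pairwiseDisjoint (by decide : (0 : ZMod 2) ≠ 1)
  have hx' : T x - μ • x ∈ G 0 := sub_mem (hT 0 x hx) (Submodule.smul_mem _ _ hx)
  have hy' : T y - μ • y ∈ G 1 := sub_mem (hT 1 y hy) (Submodule.smul_mem _ _ hy)
  have hsum : (T x - μ • x) + (T y - μ • y) = 0 := by
    rw [Module.End.mem_eigenspace_iff, map_add] at hv
    rw [sub_add_sub_comm, hv, smul_add, sub_self]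
  have hx0 : T x - μ • x = 0 := by
    refine Submodule.disjoint_def.1 hdisj _ hx' ?_
    rw [eq_neg_of_add_eq_zero_left hsum]
    exact neg_mem hy'
  have hy0 : T y - μ • y = 0 := by rwa [hx0, zero_add] at hsum
  rw [iSup_zmod_two]
  exact Submodule.add_mem_sup ⟨Module.End.mem_eigenspace_iff.2 (sub_eq_zero.1 hx0), hx⟩
    ⟨Module.End.mem_eigenspace_iff.2 (sub_eq_zero.1 hy0), hy⟩

end Grading

namespace SuperRep

open RamondIndex

variable {V : Type*} [AddCommGroup V] [Module ℂ V] (M : SuperRep ramond V)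

/-- The action of a basis element. -/
noncomputable def act (i : RamondIndex) : Module.End ℂ V := M.action (Finsupp.single i 1)

theorem action_single (i : RamondIndex) (t : ℂ) (v : V) :
    M.action (Finsupp.single i t) v = t • M.act i v := by
  rw [act, ← LinearMap.smul_apply, ← map_smul, Finsupp.smul_single, smul_eq_mul, mul_one]

theorem act_act (i j : RamondIndex) (v : V) : M.act i (M.act j v) =
    superSign i.parity j.parity • M.act j (M.act i v) + M.action (br i j) v := by
  have h := M.action_bracket (single_mem_gr (i := i) rfl 1) (single_mem_gr (i := j) rfl 1) v
  change M.action (bracket _ _) v = _ at h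
  rw [bracket_single, mul_one, one_smul] at h
  rw [h, act, act]
  abel

theorem act_mem (i : RamondIndex) {τ : ZMod 2} {v : V} (hv : v ∈ M.grading τ) :
    M.act i v ∈ M.grading (i.parity + τ) :=
  M.action_mem (single_mem_gr (i := i) rfl 1) hv

theorem act_even_mem {i : RamondIndex} (hi : i.parity = 0) (τ : ZMod 2) :
    ∀ v ∈ M.grading τ, M.act i v ∈ M.grading τ := fun v hv => by
  simpa [hi] using M.act_mem i hv

theorem action_mem_of_span {s : Set RamondIndex} {U : Submodule ℂ V} {u : V}
    (h : ∀ i ∈ s, M.act i u ∈ U) {x : RamondIndex →₀ ℂ}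
    (hx : x ∈ Submodule.span ℂ ((fun i => Finsupp.single i (1 : ℂ)) '' s)) : M.action x u ∈ U := by
  suffices Submodule.span ℂ ((fun i => Finsupp.single i (1 : ℂ)) '' s) ≤
    U.comap (M.action.flip u) from this hx
  refine Submodule.span_le.2 ?_
  rintro _ ⟨i, hi, rfl⟩
  exact h i hi

theorem action_mem_of_act_mem {U : Submodule ℂ V} {u : V} (h : ∀ i, M.act i u ∈ U)
    (x : RamondIndex →₀ ℂ) :
    M.action x u ∈ U := by
  refine M.action_mem_of_span (s := Set.univ) (fun i _ => h i) ?_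
  rw [Set.image_univ]
  exact (Finsupp.basisSingleOne (R := ℂ)).mem_span x

theorem IsSimple.eq_top {M : SuperRep ramond V} (hM : M.IsSimple) {U : Submodule ℂ V}
    (hU : U ≤ ⨆ τ, U ⊓ M.grading τ) (hact : ∀ i, ∀ u ∈ U, M.act i u ∈ U) (hne : U ≠ ⊥) : U = ⊤ :=
  (hM.2.2 U ⟨hU, fun x _ u hu => M.action_mem_of_act_mem (fun i => hact i u hu) x⟩
    le_top).resolve_left hne

theorem iSupIndep_grading : iSupIndep M.grading := M.isInternal.submodule_iSupIndep

theorem iSup_grading : ⨆ τ, M.grading τ = ⊤ := M.isInternal.submodule_iSup_eq_top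

theorem eigenspace_act_le {i : RamondIndex} (hi : i.parity = 0) (μ : ℂ) :
    (M.act i).eigenspace μ ≤ ⨆ τ, (M.act i).eigenspace μ ⊓ M.grading τ :=
  eigenspace_le_iSup_inf M.iSupIndep_grading M.iSup_grading (M.act_even_mem hi) μ

theorem finite_eigenspace {p : ℕ} (hp : M.DimLE p) (μ : ℂ) :
    FiniteDimensional ℂ ((M.act (L 0)).eigenspace μ) ∧
      Module.finrank ℂ ((M.act (L 0)).eigenspace μ) ≤ p + p := by
  have hle := M.eigenspace_act_le (i := L 0) rfl μ
  rw [iSup_zmod_two] at hle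
  obtain ⟨hf0, h0⟩ := hp μ 0
  obtain ⟨hf1, h1⟩ := hp μ 1
  change FiniteDimensional ℂ ↥((M.act (L 0)).eigenspace μ ⊓ M.grading 0) at hf0
  change FiniteDimensional ℂ ↥((M.act (L 0)).eigenspace μ ⊓ M.grading 1) at hf1
  exact ⟨Submodule.finiteDimensional_of_le hle, (Submodule.finrank_mono hle).trans
    ((Submodule.finrank_add_le_finrank_add_finrank _ _).trans (add_le_add h0 h1))⟩

variable {M}

theorem exists_weight_ne_bot (hM : M.IsSimple) (hcusp : M.IsCuspidal) :
    ∃ μ τ, (M.act (L 0)).eigenspace μ ⊓ M.grading τ ≠ ⊥ := by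
  by_contra! hb
  refine hM.2.1 ?_
  rw [← hcusp.1]
  refine iSup_eq_bot.2 fun μ => le_bot_iff.1 ?_
  refine (M.eigenspace_act_le (i := L 0) rfl μ).trans (iSup_le fun τ => (hb μ τ).le)

/-- An operator of degree zero commuting with `L_0` has a homogeneous eigenvector. -/
theorem exists_homogeneous_eigenvector (hM : M.IsSimple) (hcusp : M.IsCuspidal)
    {T : Module.End ℂ V} (hT : ∀ v, M.act (L 0) (T v) = T (M.act (L 0) v))
    (hpar : ∀ τ, ∀ v ∈ M.grading τ, T v ∈ M.grading τ) :
    ∃ (μ : ℂ) (τ : ZMod 2) (c : ℂ) (v : V),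
      v ∈ (M.act (L 0)).eigenspace μ ∧ v ∈ M.grading τ ∧ T v = c • v ∧ v ≠ 0 := by
  obtain ⟨μ, τ, hne⟩ := exists_weight_ne_bot hM hcusp
  obtain ⟨p, -, hp⟩ := hcusp.2
  have hfin : FiniteDimensional ℂ ↥((M.act (L 0)).eigenspace μ ⊓ M.grading τ) := (hp μ τ).1
  have hnt := Submodule.nontrivial_iff_ne_bot.2 hne
  have hmaps : ∀ v ∈ (M.act (L 0)).eigenspace μ ⊓ M.grading τ,
      T v ∈ (M.act (L 0)).eigenspace μ ⊓ M.grading τ := fun v hv => by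
    refine ⟨Module.End.mem_eigenspace_iff.2 ?_, hpar τ v hv.2⟩
    rw [hT, Module.End.mem_eigenspace_iff.1 hv.1, map_smul]
  obtain ⟨c, hc⟩ := Module.End.exists_eigenvalue (T.restrict hmaps)
  obtain ⟨v, hv, hv0⟩ := hc.exists_hasEigenvector
  refine ⟨μ, τ, c, v, v.2.1, v.2.2, ?_, fun h => hv0 (Subtype.ext h)⟩
  exact congrArg Subtype.val (Module.End.mem_eigenspace_iff.1 hv)

/-- Schur's lemma: an eigenspace of the even central element `C` is a graded submodule. -/
theorem exists_central_charge (hM : M.IsSimple) (hcusp : M.IsCuspidal) :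
    ∃ c : ℂ, ∀ v, M.act C v = c • v := by
  have hcomm : ∀ i v, M.act C (M.act i v) = M.act i (M.act C v) := fun i v => by
    rw [act_act, show C.parity = 0 from rfl, superSign_zero_left]
    simp [br]
  obtain ⟨μ, τ, c, v, -, -, hv, hv0⟩ := exists_homogeneous_eigenvector hM hcusp
    (fun v => (hcomm (L 0) v).symm) (M.act_even_mem (i := C) rfl)
  refine ⟨c, fun w => ?_⟩
  have := hM.eq_top (M.eigenspace_act_le (i := C) rfl c) (fun i u hu => ?_)
    (fun hb => hv0 (by simpa [hb] using Module.End.mem_eigenspace_iff.2 hv))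
  · rw [← Module.End.mem_eigenspace_iff, this]; trivial
  · rw [Module.End.mem_eigenspace_iff] at hu ⊢
    rw [hcomm, hu, map_smul]

theorem act_H_act_H {c : ℂ} (hc : ∀ v, M.act C v = c • v) (m n : ℤ) (v : V) :
    M.act (H m) (M.act (H n) v) =
      M.act (H n) (M.act (H m) v) + (if m + n = 0 then (m : ℂ) / 3 * c else 0) • v := by
  rw [act_act]
  simp only [parity, superSign_zero_left, one_smul, br, centre, action_single, hc]
  split_ifs <;> simp [smul_smul]

theorem act_H_mem_eigenspace (M : SuperRep ramond V) {μ : ℂ} (m : ℤ) {v : V}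
    (hv : v ∈ (M.act (L 0)).eigenspace μ) :
    M.act (H m) v ∈ (M.act (L 0)).eigenspace (μ + m) := by
  rw [Module.End.mem_eigenspace_iff] at hv ⊢
  rw [act_act]
  simp only [parity, superSign_zero_left, one_smul, br, action_single, hv, map_smul, zero_add]
  module

theorem act_C_eq_zero (hM : M.IsSimple) (hcusp : M.IsCuspidal) (v : V) : M.act C v = 0 := by
  obtain ⟨c, hc⟩ := exists_central_charge hM hcusp
  obtain ⟨p, -, hp⟩ := hcusp.2
  have hnt : Nontrivial V := (Submodule.nontrivial_iff ℂ).1 ⟨⟨⊤, ⊥, hM.2.1⟩⟩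
  have hH := act_H_act_H hc
  have h0 : 1 / 3 * c = 0 := by
    refine heisenberg_charge_eq_zero (fun μ => (M.act (L 0)).eigenspace μ) hcusp.1 (p + p)
      (M.finite_eigenspace hp) (a := M.act (H 1)) (b := M.act (H (-1))) (p := M.act (H 2))
      (q := M.act (H (-2))) ?_ ?_ ?_ ?_ ?_ ?_
    · refine LinearMap.ext fun v => ?_
      simpa [Module.algebraMap_end_apply, mul_smul, smul_comm c] using hH 1 (-1) v
    · refine LinearMap.ext fun v => (hH (-2) 2 v).trans ?_
      change _ + _ = M.act (H 2) (M.act (H (-2)) v) + (-(2 * (1 / 3 * c))) • v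
      rw [if_pos (by norm_num)]
      push_cast
      module
    · refine LinearMap.ext fun v => ?_
      simpa using hH 1 2 v
    · refine LinearMap.ext fun v => ?_
      simpa using hH (-1) 2 v
    · intro μ v hv
      have := M.act_H_mem_eigenspace (-1)
        (M.act_H_mem_eigenspace (-1) (M.act_H_mem_eigenspace 2 hv))
      rwa [show μ + (2 : ℤ) + (-1 : ℤ) + (-1 : ℤ) = μ by push_cast; ring] at this
    · intro μ v hv
      have := M.act_H_mem_eigenspace 1 (M.act_H_mem_eigenspace (-1) hv)
      rwa [show μ + (-1 : ℤ) + (1 : ℤ) = μ by push_cast; ring] at this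
  have : c = 0 := by simpa using h0
  rw [hc, this, zero_smul]

/-- The basis operators of a module on which the centre acts as zero. -/
noncomputable def n2Ops (M : SuperRep ramond V) (hC : ∀ v, M.act C v = 0) : N2Ops V where
  L m := M.act (L m)
  H m := M.act (H m)
  P m := M.act (Gp m)
  Q m := M.act (Gm m)
  LL m n v := by
    rw [act_act]
    simp [parity, superSign_zero_left, br, centre, action_single, hC, sub_smul]
  LH m n v := by
    rw [act_act]
    simp [parity, superSign_zero_left, br, action_single]
  HH m n v := by
    rw [act_act]
    simp [parity, superSign_zero_left, br, centre, action_single, hC]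
  LP m n v := by
    rw [act_act]
    simp [parity, superSign_zero_left, br, action_single, sub_smul]
  LQ m n v := by
    rw [act_act]
    simp [parity, superSign_zero_left, br, action_single, sub_smul]
  HP m n v := by
    rw [act_act]
    simp [parity, superSign_zero_left, br, action_single]
  HQ m n v := by
    rw [act_act]
    simp [parity, superSign_zero_left, br, action_single, sub_eq_add_neg]
  PP m n v := by
    rw [act_act]
    simp [parity, superSign_one_one, br]
  QQ m n v := by
    rw [act_act]
    simp [parity, superSign_one_one, br]
  PQ m n v := by
    rw [act_act]
    simp [parity, superSign_one_one, br, centre, action_single, hC, sub_smul, add_assoc]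

end SuperRep
-- Parity along the levels, and simplicity over the subalgebras.
namespace SuperRep

open RamondIndex

variable {V : Type*} [AddCommGroup V] [Module ℂ V] {M : SuperRep ramond V}
  {hC : ∀ v, M.act C v = 0} {lam h : ℂ} {τ : ZMod 2} {v : V} {N : ℕ}

/-- The homogeneous joint eigenspaces of a module span, when parity is prescribed along the
eigenvalues of `H_0`. -/
theorem iSup_wt_inf_grading (hM : M.IsSimple) (hv : v ∈ (M.n2Ops hC).wt lam h 0 0)
    (hτ : v ∈ M.grading τ) (hv0 : v ≠ 0) :
    (⨆ p : ℤ × ℤ, (M.n2Ops hC).wt lam h p.1 p.2 ⊓ M.grading (τ + (p.2 : ZMod 2))) = ⊤ := by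
  set A : ℤ × ℤ → Submodule ℂ V :=
    fun p => (M.n2Ops hC).wt lam h p.1 p.2 ⊓ M.grading (τ + (p.2 : ZMod 2))
  refine hM.eq_top (iSup_le fun p => ?_) (fun i => ?_) fun hb => hv0 ?_
  · exact le_iSup_of_le (τ + (p.2 : ZMod 2)) (le_inf (le_iSup A p) inf_le_right)
  · suffices (⨆ p, A p) ≤ (⨆ p, A p).comap (M.act i) from this
    refine iSup_le fun p u hu => ?_
    obtain ⟨n, k⟩ := p
    have h1 : (1 : ZMod 2) = -1 := by decide
    have hpar := M.act_mem i hu.2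
    rcases i with m | m | m | m | _ <;> simp only [parity, zero_add] at hpar
    · exact Submodule.mem_iSup_of_mem (n + m, k) ⟨N2Ops.L_wt hu.1 m, hpar⟩
    · exact Submodule.mem_iSup_of_mem (n + m, k) ⟨N2Ops.H_wt hu.1 m, hpar⟩
    · refine Submodule.mem_iSup_of_mem (n + m, k + 1) ⟨N2Ops.P_wt hu.1 m, ?_⟩
      rw [Int.cast_add, Int.cast_one, ← add_assoc, add_comm]
      exact hpar
    · refine Submodule.mem_iSup_of_mem (n + m, k - 1) ⟨N2Ops.Q_wt hu.1 m, ?_⟩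
      rw [Int.cast_sub, Int.cast_one, sub_eq_add_neg, ← h1, ← add_assoc, add_comm]
      exact hpar
    · rw [Submodule.mem_comap, hC]
      exact zero_mem _
  · have : v ∈ ⨆ p, A p := Submodule.mem_iSup_of_mem (0, 0) ⟨hv, by simpa using hτ⟩
    simpa [hb] using this

/-- The homogeneous vector `v` generates the module, and each `G^±_m` changes the level and the
parity together; the levels being independent, none can carry two parities. -/
theorem level_le_grading (hM : M.IsSimple) (hv : v ∈ (M.n2Ops hC).wt lam h 0 0)
    (hτ : v ∈ M.grading τ) (hv0 : v ≠ 0) (k : ℤ) :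
    (M.n2Ops hC).level h k ≤ M.grading (τ + (k : ZMod 2)) := by
  intro w hw
  have hmem := ((M.n2Ops hC).level_independent h).mem_of_mem_iSup
    (A := fun k => ⨆ n, (M.n2Ops hC).wt lam h n k ⊓ M.grading (τ + (k : ZMod 2)))
    (fun k => iSup_le fun n => inf_le_left.trans inf_le_right) hw (by
      rw [iSup_comm, ← iSup_prod (f := fun p : ℤ × ℤ =>
        (M.n2Ops hC).wt lam h p.1 p.2 ⊓ M.grading (τ + (p.2 : ZMod 2))),
        iSup_wt_inf_grading hM hv hτ hv0]
      trivial)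
  exact (iSup_le fun n => inf_le_right :
    (⨆ n, (M.n2Ops hC).wt lam h n k ⊓ M.grading (τ + (k : ZMod 2))) ≤ _) hmem

/-- Simplicity among graded subspaces becomes simplicity among all stable subspaces: a subspace
stable under `H_0` is the sum of its intersections with the levels, each of which has one parity. -/
theorem isSimpleBounded (hM : M.IsSimple)
    (hfin : ∀ μ, FiniteDimensional ℂ ((M.act (L 0)).eigenspace μ) ∧
      Module.finrank ℂ ((M.act (L 0)).eigenspace μ) ≤ N)
    (hv : v ∈ (M.n2Ops hC).wt lam h 0 0) (hτ : v ∈ M.grading τ) (hv0 : v ≠ 0) :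
    (M.n2Ops hC).IsSimpleBounded lam h N where
  sup_wt := by
    rw [eq_top_iff, ← iSup_wt_inf_grading hM hv hτ hv0]
    exact iSup_mono fun p => inf_le_left
  simple W hE hW hne := by
    refine hM.eq_top ?_ (fun i u hu => ?_) hne
    · refine (le_iSup_inf_eigenspace (M.act (H 0)) (g := fun k : ℤ => h + k)
        (fun a b hab => by simpa using hab) W (fun w hw => (hE w hw 0).2) ?_).trans
        (iSup_le fun k => ?_)
      · refine le_top.trans ?_
        rw [← iSup_wt_inf_grading hM hv hτ hv0]
        exact iSup_le fun p => le_iSup_of_le p.2 (inf_le_left.trans inf_le_right)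
      · exact le_iSup_of_le (τ + (k : ZMod 2))
          (inf_le_inf_left W (level_le_grading hM hv hτ hv0 k))
    · rcases i with m | m | m | m | _
      · exact (hE u hu m).1
      · exact (hE u hu m).2
      · exact (hW u hu m).1
      · exact (hW u hu m).2
      · rw [hC]; exact zero_mem _
  finite n := (hfin _).1
  finrank_le n := (hfin _).2

/-- A simple cuspidal module is a simple bounded module of some depth `d ≤ 2`, and the parity is
constant on each eigenspace of `H_0`. -/
theorem exists_hasDepth (hM : M.IsSimple) (hcusp : M.IsCuspidal) (hC : ∀ v, M.act C v = 0) :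
    ∃ (lam h : ℂ) (N d : ℕ) (τ : ZMod 2), d ≤ 2 ∧ (M.n2Ops hC).HasDepth lam h N d ∧
      ∀ k : ℤ, (M.n2Ops hC).level h k ≤ M.grading (τ + (k : ZMod 2)) := by
  obtain ⟨p, -, hp⟩ := hcusp.2
  have hfin := M.finite_eigenspace hp
  obtain ⟨μ, τ, c, v, hvμ, hvτ, hvc, hv0⟩ := exists_homogeneous_eigenvector hM hcusp
    (T := M.act (H 0)) (fun v => ((M.n2Ops hC).LH 0 0 v).trans (by simp; rfl))
    (M.act_even_mem (i := H 0) rfl)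
  have hv : v ∈ (M.n2Ops hC).wt μ c 0 0 := by
    rw [N2Ops.mem_wt, Int.cast_zero, add_zero, add_zero]
    exact ⟨Module.End.mem_eigenspace_iff.1 hvμ, hvc⟩
  have S := isSimpleBounded hM hfin hv hvτ hv0
  obtain ⟨B, hB⟩ := S.exists_level_bound
  -- The reference weights are then recentred at a vector `w` of the highest level `K`.
  obtain ⟨K, hK, hmax⟩ := Int.exists_greatest_of_bdd
    (P := fun k => (M.n2Ops hC).level c k ≠ ⊥)
    ⟨B, fun k hk => not_lt.1 fun hlt => hk (hB k hlt)⟩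
    ⟨0, fun hb => hv0 (by simpa [hb] using hv.2)⟩
  have hK' := hK
  rw [S.level_eq, Ne, iSup_eq_bot, not_forall] at hK'
  obtain ⟨n, hn⟩ := hK'
  obtain ⟨w, hw, hw0⟩ := Submodule.exists_mem_ne_zero_of_ne_bot hn
  have hwτ := level_le_grading hM hv hvτ hv0 K hw.2
  have hw' : w ∈ (M.n2Ops hC).wt (μ + n) (c + K) 0 0 := by
    rw [N2Ops.mem_wt, Int.cast_zero, add_zero, add_zero]
    exact N2Ops.mem_wt.1 hw
  have hlev : ∀ k, (M.n2Ops hC).level (c + K) k = (M.n2Ops hC).level c (K + k) := fun k => by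
    rw [N2Ops.level, N2Ops.level, Int.cast_add, add_assoc]
  have T : (M.n2Ops hC).IsTop (μ + n) (c + K) (p + p) :=
    { isSimpleBounded hM hfin hw' hwτ hw0 with
      level_zero := by rwa [hlev, add_zero]
      level_pos := fun k hk => by
        rw [hlev]
        by_contra hne
        have := hmax _ hne
        omega }
  obtain ⟨d, hd, D⟩ := T.exists_hasDepth
  exact ⟨_, _, _, d, _, hd, D, level_le_grading hM hw' hwτ hw0⟩

theorem powAct_eq_opPow {S : Submodule ℂ (RamondIndex →₀ ℂ)} {f : ℤ → RamondIndex}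
    (hS : S = Submodule.span ℂ (Set.range fun r => Finsupp.single (f r) 1)) (i : ℕ)
    (U : Submodule ℂ V) : M.powAct S i U = opPow (fun r => M.act (f r)) i U := by
  induction i with
  | zero => rfl
  | succ i ih =>
    rw [powAct, opPow, ih, hS, Submodule.span_range_eq_iSup, Submodule.map₂_iSup_left]
    exact iSup_congr fun r => by rw [Submodule.map₂_span_singleton_eq_map, act]

theorem mem_of_mem_gr_zero {U : Submodule ℂ V} (hU : (M.n2Ops hC).EvenStable U) {u : V}
    (hu : u ∈ U) {x : RamondIndex →₀ ℂ} (hx : x ∈ gr 0) : M.action x u ∈ U := by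
  rw [gr_eq_span] at hx
  refine M.action_mem_of_span (fun i hi => ?_) hx
  rcases i with m | m | m | m | _
  · exact (hU u hu m).1
  · exact (hU u hu m).2
  · exact absurd hi one_ne_zero
  · exact absurd hi one_ne_zero
  · rw [hC]; exact zero_mem _

theorem action_eq_zero_of_mem_span {S : Submodule ℂ (RamondIndex →₀ ℂ)} {f : ℤ → RamondIndex}
    (hS : S = Submodule.span ℂ (Set.range fun r => Finsupp.single (f r) 1)) {u : V}
    (hu : ∀ r, M.act (f r) u = 0) {x : RamondIndex →₀ ℂ} (hx : x ∈ S) : M.action x u = 0 := by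
  rw [← Submodule.mem_bot ℂ]
  refine M.action_mem_of_span (s := Set.range f) ?_
    (by rwa [← Set.range_comp, Function.comp_def, ← hS])
  rintro _ ⟨r, rfl⟩
  rw [hu, Submodule.mem_bot]

/-- As `S` acts by zero on `U`, only stability under the even part matters, and `U`, having one
parity, is graded. -/
theorem isSimpleSubmodule_of_even {S : Submodule ℂ (RamondIndex →₀ ℂ)} {f : ℤ → RamondIndex}
    (hS : S = Submodule.span ℂ (Set.range fun r => Finsupp.single (f r) 1)) {U : Submodule ℂ V}
    (hpar : U ≤ M.grading τ) (hE : (M.n2Ops hC).EvenStable U) (hne : U ≠ ⊥)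
    (hkill : ∀ u ∈ U, ∀ r, M.act (f r) u = 0)
    (hmin : ∀ W ≤ U, (M.n2Ops hC).EvenStable W → W ≠ ⊥ → W = U) :
    M.IsSimpleSubmodule (gr 0 ⊔ S) U := by
  refine ⟨⟨le_iSup_of_le τ (le_inf le_rfl hpar), fun x hx u hu => ?_⟩, hne, fun W hW hWU => ?_⟩
  · obtain ⟨y, hy, z, hz, rfl⟩ := Submodule.mem_sup.1 hx
    rw [map_add, LinearMap.add_apply, action_eq_zero_of_mem_span hS (hkill u hu) hz, add_zero]
    exact mem_of_mem_gr_zero hE hu hy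
  · refine or_iff_not_imp_left.2 (hmin W hWU fun w hw m => ⟨?_, ?_⟩)
    · exact hW.2 _ (Submodule.mem_sup_left (single_mem_gr (i := L m) rfl 1)) w hw
    · exact hW.2 _ (Submodule.mem_sup_left (single_mem_gr (i := H m) rfl 1)) w hw

/-! ### Dimensions of the homogeneous weight spaces, and the length. -/

section Dimension

theorem zmod_two_eq_or (σ τ : ZMod 2) : σ = τ ∨ σ = τ + 1 := by
  revert σ τ; decide

variable {d : ℕ}

theorem grading_le_iSup_level (D : (M.n2Ops hC).HasDepth lam h N d)
    (hpar : ∀ k : ℤ, (M.n2Ops hC).level h k ≤ M.grading (τ + (k : ZMod 2))) (σ : ZMod 2) :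
    M.grading σ ≤ ⨆ i ∈ Finset.range (d + 1), ⨆ (_ : τ + ((-(i : ℤ) : ℤ) : ZMod 2) = σ),
      (M.n2Ops hC).level h (-i) := by
  refine fun x hx => M.iSupIndep_grading.mem_of_mem_iSup
    (A := fun σ => ⨆ i ∈ Finset.range (d + 1), ⨆ (_ : τ + ((-(i : ℤ) : ℤ) : ZMod 2) = σ),
      (M.n2Ops hC).level h (-i)) (fun σ => ?_) hx ?_
  · exact iSup_le fun i => iSup_le fun _ => iSup_le fun hi => (hpar _).trans (by rw [hi])
  · refine (le_top.trans_eq D.iSup_level.symm).trans ?_ (Submodule.mem_top (x := x))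
    refine iSup₂_le fun i hi => ?_
    exact le_iSup_of_le _ (le_iSup₂_of_le i hi (le_iSup_of_le rfl le_rfl))

theorem eigenspace_inf_iSup_level_le (S : (M.n2Ops hC).IsSimpleBounded lam h N) (n k l : ℤ) :
    (M.act (L 0)).eigenspace (lam + n) ⊓
      ((M.n2Ops hC).level h k ⊔ (M.n2Ops hC).level h l) ≤
      (M.n2Ops hC).wt lam h n k ⊔ (M.n2Ops hC).wt lam h n l := by
  rintro x ⟨hx, hx'⟩
  refine ((Module.End.eigenspaces_iSupIndep (M.act (L 0))).comp (f := fun n : ℤ => lam + (n : ℂ))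
    fun a b hab => by simpa using hab).mem_of_mem_iSup
    (A := fun n => (M.n2Ops hC).wt lam h n k ⊔ (M.n2Ops hC).wt lam h n l)
    (fun n => sup_le inf_le_left inf_le_left) hx ?_
  rwa [iSup_sup_eq, ← S.level_eq, ← S.level_eq]

theorem grading_le_even (D : (M.n2Ops hC).HasDepth lam h N d) (hd : d ≤ 2)
    (hpar : ∀ k : ℤ, (M.n2Ops hC).level h k ≤ M.grading (τ + (k : ZMod 2))) :
    M.grading τ ≤ (M.n2Ops hC).level h 0 ⊔ (M.n2Ops hC).level h (-2) := by
  refine (grading_le_iSup_level D hpar τ).trans (iSup₂_le fun i hi => iSup_le fun hiτ => ?_)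
  have hi' : i ≤ 2 := by rw [Finset.mem_range] at hi; omega
  interval_cases i
  · exact le_sup_left
  · exact absurd (add_eq_left.1 hiτ) (by decide)
  · exact le_sup_right

theorem grading_le_odd (D : (M.n2Ops hC).HasDepth lam h N d) (hd : d ≤ 2)
    (hpar : ∀ k : ℤ, (M.n2Ops hC).level h k ≤ M.grading (τ + (k : ZMod 2))) :
    M.grading (τ + 1) ≤ (M.n2Ops hC).level h (-1) := by
  refine (grading_le_iSup_level D hpar _).trans (iSup₂_le fun i hi => iSup_le fun hiτ => ?_)
  have hi' : i ≤ 2 := by rw [Finset.mem_range] at hi; omega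
  interval_cases i
  · exact absurd (add_left_cancel hiτ) (by decide)
  · exact le_rfl
  · exact absurd (add_left_cancel hiτ) (by decide)

theorem eigenspace_eq_bot (S : (M.n2Ops hC).IsSimpleBounded lam h N) {μ : ℂ}
    (hμ : ∀ n : ℤ, μ ≠ lam + n) : (M.act (L 0)).eigenspace μ = ⊥ := by
  classical
  rw [eq_bot_iff]
  intro x hx
  let A : ℂ → Submodule ℂ V := fun μ =>
    if ∃ n : ℤ, μ = lam + n then (M.act (L 0)).eigenspace μ else ⊥
  have hA : ∀ ν, A ν ≤ (M.act (L 0)).eigenspace ν := fun ν => by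
    by_cases hν : ∃ n : ℤ, ν = lam + n <;> simp [A, hν]
  have := (Module.End.eigenspaces_iSupIndep (M.act (L 0))).mem_of_mem_iSup hA hx (by
    refine (le_top.trans_eq S.sup_wt.symm).trans ?_ (Submodule.mem_top (x := x))
    refine iSup_le fun p => inf_le_left.trans (le_iSup_of_le (lam + p.1) ?_)
    simp only [A]
    rw [if_pos ⟨p.1, rfl⟩]
    rfl)
  simpa [A, hμ] using this

theorem dimLE_of_wt (D : (M.n2Ops hC).HasDepth lam h N d) (hd : d ≤ 2)
    (hpar : ∀ k : ℤ, (M.n2Ops hC).level h k ≤ M.grading (τ + (k : ZMod 2))) {q : ℕ}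
    (heven : ∀ n, Module.finrank ℂ ((M.n2Ops hC).wt lam h n 0) +
      Module.finrank ℂ ((M.n2Ops hC).wt lam h n (-2)) ≤ q)
    (hodd : ∀ n, Module.finrank ℂ ((M.n2Ops hC).wt lam h n (-1)) ≤ q) : M.DimLE q := by
  intro μ σ
  change FiniteDimensional ℂ ↥((M.act (L 0)).eigenspace μ ⊓ M.grading σ) ∧
    Module.finrank ℂ ↥((M.act (L 0)).eigenspace μ ⊓ M.grading σ) ≤ q
  by_cases hμ : ∃ n : ℤ, μ = lam + n
  · obtain ⟨n, rfl⟩ := hμ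
    have hfin : FiniteDimensional ℂ ((M.act (L 0)).eigenspace (lam + n)) := D.finite n
    have hw : ∀ k, FiniteDimensional ℂ ((M.n2Ops hC).wt lam h n k) := fun k =>
      Submodule.finiteDimensional_of_le (inf_le_left : _ ≤ (M.act (L 0)).eigenspace (lam + n))
    refine ⟨Submodule.finiteDimensional_of_le
      (inf_le_left : _ ≤ (M.act (L 0)).eigenspace (lam + n)), ?_⟩
    obtain hσ | hσ := zmod_two_eq_or σ τ
    · subst hσ
      have hle := (inf_le_inf_left ((M.act (L 0)).eigenspace (lam + n))
        (grading_le_even D hd hpar)).trans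
        (eigenspace_inf_iSup_level_le D.toIsSimpleBounded n 0 (-2))
      exact (Submodule.finrank_mono hle).trans
        ((Submodule.finrank_add_le_finrank_add_finrank _ _).trans (heven n))
    · subst hσ
      have hle : (M.act (L 0)).eigenspace (lam + n) ⊓ M.grading (τ + 1) ≤
          (M.n2Ops hC).wt lam h n (-1) :=
        inf_le_inf_left _ (grading_le_odd D hd hpar)
      exact (Submodule.finrank_mono hle).trans (hodd n)
  · push Not at hμ
    rw [eigenspace_eq_bot D.toIsSimpleBounded hμ, bot_inf_eq]
    exact ⟨inferInstance, by simp⟩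

theorem dimLE_two (D : (M.n2Ops hC).HasDepth lam h N d) (hd : d ≤ 2)
    (hpar : ∀ k : ℤ, (M.n2Ops hC).level h k ≤ M.grading (τ + (k : ZMod 2))) : M.DimLE 2 :=
  dimLE_of_wt D hd hpar
    (fun n => add_le_add (D.finrank_wt_le.1 n) (D.finrank_wt_le.2.2.1 n)) D.finrank_wt_le.2.1

/-- In depth 1 the level `-1` is the lowest one, so the symmetry improves its multiplicity bound
from 2 to 1. -/
theorem dimLE_one (D : (M.n2Ops hC).HasDepth lam h N d) (hd : d ≤ 1)
    (hpar : ∀ k : ℤ, (M.n2Ops hC).level h k ≤ M.grading (τ + (k : ZMod 2))) : M.DimLE 1 := by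
  have hbot : ∀ k : ℤ, k < -d → ∀ n, Module.finrank ℂ ((M.n2Ops hC).wt lam h n k) = 0 :=
    fun k hk n => by
      rw [N2Ops.wt, D.level_below k hk, inf_bot_eq, finrank_bot]
  refine dimLE_of_wt D (by omega) hpar (fun n => ?_) fun n => ?_
  · rw [hbot (-2) (by omega)]
    exact D.finrank_wt_le.1 n
  · obtain rfl | rfl : d = 0 ∨ d = 1 := by omega
    · rw [hbot (-1) (by norm_num)]; exact zero_le_one
    · exact D.finrank_bottom_le n

/-- In depth 2 the highest and the lowest level meet at a common weight with the same parity, and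
vectors from different levels are independent. -/
theorem not_dimLE_one (D : (M.n2Ops hC).HasDepth lam h N 2)
    (hpar : ∀ k : ℤ, (M.n2Ops hC).level h k ≤ M.grading (τ + (k : ZMod 2))) : ¬ M.DimLE 1 := by
  intro hone
  obtain ⟨n, h0, h2⟩ := D.exists_wt_ne_bot two_ne_zero
  obtain ⟨x, hx, hx0⟩ := Submodule.exists_mem_ne_zero_of_ne_bot h0
  obtain ⟨y, hy, hy0⟩ := Submodule.exists_mem_ne_zero_of_ne_bot h2
  obtain ⟨hfin, hle⟩ := hone (lam + n) τ
  have hxm : x ∈ M.weightSpace (lam + n) ⊓ M.grading τ := ⟨hx.1, by simpa using hpar 0 hx.2⟩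
  have hym : y ∈ M.weightSpace (lam + n) ⊓ M.grading τ := by
    refine ⟨hy.1, ?_⟩
    have := hpar _ hy.2
    rwa [show (((-(2 : ℕ) : ℤ)) : ZMod 2) = 0 by decide, add_zero] at this
  obtain ⟨c, hc⟩ := (finrank_le_one_iff.1 hle)
  obtain ⟨a, ha⟩ := hc ⟨x, hxm⟩
  obtain ⟨b, hb⟩ := hc ⟨y, hym⟩
  have hab : b • x = a • y := by
    have h1 := congrArg Subtype.val ha
    have h2 := congrArg Subtype.val hb
    simp only [Submodule.coe_smul] at h1 h2
    rw [← h1, ← h2, smul_comm]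
  have hb0 : b ≠ 0 := by
    rintro rfl
    exact hy0 (by simpa using (congrArg Subtype.val hb).symm)
  have hxb : x ∈ (M.n2Ops hC).level h (-(2 : ℕ)) := by
    rw [← Submodule.smul_mem_iff _ hb0, hab]
    exact Submodule.smul_mem _ _ hy.2
  have hdisj := ((M.n2Ops hC).level_independent h).pairwiseDisjoint
    (show (0 : ℤ) ≠ -(2 : ℕ) by norm_num)
  exact hx0 (Submodule.disjoint_def.1 hdisj x hx.2 hxb)

end Dimension

end SuperRep

/-! ### The proposition. -/

open RamondIndex in
theorem proposition4p1 {V : Type*} [AddCommGroup V] [Module ℂ V] (M : SuperRep ramond V)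
    (hsimple : M.IsSimple) (hcusp : M.IsCuspidal) :
    M.DimLE 2 ∧
    ∃ p : ℕ, M.IsLength p ∧ (p = 1 ∨ p = 2) ∧
    ∃ n : ℕ, n ≤ 2 ∧ (M.IsNontrivial → n = p) ∧
    ∃ Up Um : Submodule ℂ V,
      M.IsSimpleSubmodule qPlus Up ∧ M.IsSimpleSubmodule qMinus Um ∧
      (∀ x ∈ spanGp, ∀ u ∈ Up, M.action x u = 0) ∧
      (∀ x ∈ spanGm, ∀ u ∈ Um, M.action x u = 0) ∧
      (⨆ i ∈ Finset.range (n + 1), M.powAct spanGm i Up) = ⊤ ∧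
      (⨆ i ∈ Finset.range (n + 1), M.powAct spanGp i Um) = ⊤ ∧
      ∀ i ≤ n, M.powAct spanGm i Up = M.powAct spanGp (n - i) Um := by
  have hC := SuperRep.act_C_eq_zero hsimple hcusp
  obtain ⟨lam, h, N, d, τ, hd, D, hpar⟩ := SuperRep.exists_hasDepth hsimple hcusp hC
  set O := M.n2Ops hC
  have hQ : ∀ i U, M.powAct spanGm i U = opPow O.Q i U := M.powAct_eq_opPow rfl
  have hP : ∀ i U, M.powAct spanGp i U = opPow O.P i U := M.powAct_eq_opPow rfl
  have hkillP : ∀ u ∈ O.level h 0, ∀ r, M.act (Gp r) u = 0 := fun u hu r => D.P_eq_zero hu r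
  have hbot : O.swap.level (-h + (d : ℤ)) 0 = O.level h (-d) := by
    rw [N2Ops.swap_level, sub_zero]
  have hkillQ : ∀ u ∈ O.level h (-d), ∀ r, M.act (Gm r) u = 0 := fun u hu r =>
    D.swap.P_eq_zero (v := u) (by rwa [hbot]) r
  have htwo := SuperRep.dimLE_two D hd hpar
  -- The depth equals the length except for depth 0, where the length is 1 and the algebra acts as
  -- zero.
  have hlen : ∃ p, M.IsLength p ∧ (p = 1 ∨ p = 2) ∧ (M.IsNontrivial → d = p) := by
    obtain hd1 | rfl : d ≤ 1 ∨ d = 2 := by omega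
    · refine ⟨1, ⟨⟨one_pos, SuperRep.dimLE_one D hd1 hpar⟩, fun q hq => hq.1⟩, Or.inl rfl, ?_⟩
      rintro ⟨x, v, hxv⟩
      by_contra hne
      obtain rfl : d = 0 := by omega
      refine hxv ?_
      rw [← Submodule.mem_bot ℂ]
      refine M.action_mem_of_act_mem (fun i => ?_) x
      rw [Submodule.mem_bot]
      rcases i with m | m | m | m | _
      · exact (D.eq_zero m v).1
      · exact (D.eq_zero m v).2.1
      · exact (D.eq_zero m v).2.2.1
      · exact (D.eq_zero m v).2.2.2
      · exact hC v
    · refine ⟨2, ⟨⟨two_pos, htwo⟩, fun q hq => ?_⟩, Or.inr rfl, fun _ => rfl⟩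
      by_contra hlt
      have hq0 := hq.1
      obtain rfl : q = 1 := by omega
      exact SuperRep.not_dimLE_one D hpar hq.2
  obtain ⟨p, hp, hp12, hdp⟩ := hlen
  refine ⟨htwo, p, hp, hp12, d, hd, hdp, O.level h 0, O.level h (-d), ?_, ?_, ?_, ?_, ?_, ?_, ?_⟩
  · exact SuperRep.isSimpleSubmodule_of_even rfl (hpar 0) (O.evenStable_level h 0) D.level_zero
      hkillP fun W hW hE hne => D.eq_level_zero hW hE hne
  · refine SuperRep.isSimpleSubmodule_of_even rfl (hpar _) (O.evenStable_level h _) D.level_bottom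
      hkillQ fun W hW hE hne => ?_
    rw [← hbot] at hW ⊢
    refine D.swap.eq_level_zero hW (fun w hw m => ⟨(hE w hw m).1, ?_⟩) hne
    exact neg_mem (hE w hw m).2
  · exact fun x hx u hu => SuperRep.action_eq_zero_of_mem_span rfl (hkillP u hu) hx
  · exact fun x hx u hu => SuperRep.action_eq_zero_of_mem_span rfl (hkillQ u hu) hx
  · simp only [hQ]
    exact D.iSup_opPow_Q
  · simp only [hP]
    exact D.iSup_opPow_P
  · intro i hi
    rw [hQ, hP]
    exact D.opPow_Q_eq_opPow_P hi
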